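/- Let $Q\subset\mathbb R^n$ be an $n$-dimensional even lattice polytope with vertex set $V(Q)\subset(2\mathbb N)^n$ (here $0\in\mathbb N$), and let $y\in\operatorname{int}(Q)\cap\mathbb N^n$. Put $$C(y)=\Big\{\lambda\in\mathbb R_{\ge 0}^{V(Q)} : \sum_{v}\lambda_v=1,\ \sum_{v}\lambda_v v=y\Big\},\qquad f(Q,\lambda,y)=\sum_{v\in V(Q)}\lambda_v\mathbf x^{v}-\mathbf x^{y},$$ and let $\mathrm{SOS}(Q,y)$ be the set of all $\lambda\in C(y)$ for which $f(Q,\lambda,y)$ is a sum of squares of polynomials in $\mathbb R[x_1,\dots,x_n]$. An agiform on $V(Q)\cup\{y\}$ is a polynomial $f(Q,\lambda,y)$ with $\lambda\in C(y)$ and all $\lambda_v>0$. For a lattice simplex $\Delta$ with vertex set $\hat\Delta$, a set $L\subseteq\Delta\cap\mathbb Z^n$ is called $\hat\Delta$-mediated if $\hat\Delta\subseteq L$ and every $\beta\in L\setminus\hat\Delta$ is the midpoint of two distinct points of $L\cap(2\mathbb Z)^n$; $\Delta^*$ denotes the largest $\hat\Delta$-mediated set (the union of all of them). Then the following are equivalent: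 1. $\mathrm{SOS}(Q,y)=C(y)$; 2. every agiform on $V(Q)\cup\{y\}$ is a sum of squares; 3. for every triangulation $Q=Q_1\cup\dots\cup Q_r$ all of whose vertices are vertices of $Q$, and for every $1\le j\le r$: if $y\in Q_j$, then $y\in Q_j^*$. -/

import Mathlib

namespace Agiform

noncomputable section

/-- The point of `ℝⁿ` given by an exponent vector in `ℕⁿ`. -/
def pt {n : ℕ} (a : Fin n →₀ ℕ) : Fin n → ℝ := fun i => (a i : ℝ)

/-- `Q ⊆ ℝⁿ` is a lattice polytope whose set of vertices `V(Q)` is exactly (the image in `ℝⁿ` of)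
the finite set `V ⊆ ℕⁿ`. -/
structure IsLatticePolytope {n : ℕ} (Q : Set (Fin n → ℝ)) (V : Finset (Fin n →₀ ℕ)) : Prop where
  eq_convexHull : Q = convexHull ℝ (pt '' (V : Set (Fin n →₀ ℕ)))
  extremePoints_eq : Q.extremePoints ℝ = pt '' (V : Set (Fin n →₀ ℕ))

/-- The polytope `C(y)` of all `λ` (indexed by the vertices) that write `y` as a convex combination
of the vertices. -/
def convexCombs {n : ℕ} (V : Finset (Fin n →₀ ℕ)) (y : Fin n →₀ ℕ) : Set (V → ℝ) :=
  {l | (∀ v, 0 ≤ l v) ∧ ∑ v, l v = 1 ∧ ∑ v, l v • pt (v : Fin n →₀ ℕ) = pt y}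

/-- The polynomial `f(Q, λ, y) = ∑ λ_v x^v - x^y`, the sum being over the vertices `v` of `Q`. -/
def poly {n : ℕ} (V : Finset (Fin n →₀ ℕ)) (l : V → ℝ) (y : Fin n →₀ ℕ) :
    MvPolynomial (Fin n) ℝ :=
  ∑ v : V, MvPolynomial.monomial (v : Fin n →₀ ℕ) (l v) - MvPolynomial.monomial y 1

/-- `f` is an agiform on `V(Q) ∪ {y}`: all vertex coefficients are strictly positive, they express
`y` as a convex combination of the vertices, and the coefficient of `x^y` is `-1`. -/
def IsAgiform {n : ℕ} (V : Finset (Fin n →₀ ℕ)) (y : Fin n →₀ ℕ)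
    (f : MvPolynomial (Fin n) ℝ) : Prop :=
  ∃ b ∈ convexCombs V y, (∀ v, 0 < b v) ∧ f = poly V b y

/-- `SOS(f, y)`: those `λ ∈ C(y)` for which `f(Q, λ, y)` is a sum of squares of real polynomials.
It depends on `f` only through the vertex set of its Newton polytope `Q`. -/
def sosSet {n : ℕ} (V : Finset (Fin n →₀ ℕ)) (y : Fin n →₀ ℕ) : Set (V → ℝ) :=
  {l | l ∈ convexCombs V y ∧ IsSumSq (poly V l y)}

/-- A point of `ℤⁿ`, viewed in `ℝⁿ`. -/
def IsLatticePoint {n : ℕ} (x : Fin n → ℝ) : Prop := ∀ i, ∃ k : ℤ, x i = k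

/-- A point of `(2ℤ)ⁿ`, viewed in `ℝⁿ`. -/
def IsEvenPoint {n : ℕ} (x : Fin n → ℝ) : Prop := ∀ i, ∃ k : ℤ, x i = 2 * k

/-- `L ⊆ conv(D) ∩ ℤⁿ` is `D`-mediated: it contains `D`, and every point of `L` outside `D` is the
midpoint of two distinct even points of `L`. -/
structure IsMediated {n : ℕ} (D L : Set (Fin n → ℝ)) : Prop where
  subset_convexHull : L ⊆ convexHull ℝ D
  isLatticePoint : ∀ x ∈ L, IsLatticePoint x
  vertices_subset : D ⊆ L
  mediated : ∀ x ∈ L, x ∉ D →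
    ∃ s ∈ L, ∃ t ∈ L, s ≠ t ∧ IsEvenPoint s ∧ IsEvenPoint t ∧ x = (1 / 2 : ℝ) • (s + t)

/-- The maximal `D`-mediated set `Δ*` of the simplex `Δ = conv(D)` with vertex set `D`. -/
def maxMediated {n : ℕ} (D : Set (Fin n → ℝ)) : Set (Fin n → ℝ) :=
  ⋃₀ {L | IsMediated D L}

/-- For lattice vertices, `maxMediated D` really is the largest `D`-mediated set. -/
theorem isGreatest_maxMediated {n : ℕ} (D : Set (Fin n → ℝ)) (hD : ∀ x ∈ D, IsLatticePoint x) :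
    IsGreatest {L | IsMediated D L} (maxMediated D) := by
  refine ⟨⟨?_, ?_, ?_, ?_⟩, fun L hL => Set.subset_sUnion_of_mem hL⟩
  · exact Set.sUnion_subset fun L hL => hL.subset_convexHull
  · rintro x ⟨L, hL, hx⟩
    exact hL.isLatticePoint x hx
  · exact Set.subset_sUnion_of_mem (show D ∈ {L | IsMediated D L} from
      ⟨subset_convexHull ℝ D, hD, subset_rfl, fun x hx h => absurd hx h⟩)
  · rintro x ⟨L, hL, hx⟩ hxD
    obtain ⟨s, hs, t, ht, h⟩ := hL.mediated x hx hxD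
    exact ⟨s, ⟨L, hL, hs⟩, t, ⟨L, hL, ht⟩, h⟩

/-- `K` is a triangulation of `Q` without new vertices. -/
structure IsTriangulation {n : ℕ} (Q : Set (Fin n → ℝ))
    (K : Geometry.SimplicialComplex ℝ (Fin n → ℝ)) : Prop where
  space_eq : K.space = Q
  vertices_subset : K.vertices ⊆ Q.extremePoints ℝ

/-- For every triangulation of `Q` without new vertices, every simplex of the triangulation that
contains `y` has `y` in its maximal mediated set. The simplices `Q₁, …, Q_r` of a triangulation
`Q = Q₁ ∪ … ∪ Q_r` are the maximal faces of the complex. -/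
def TriangulationCriterion {n : ℕ} (Q : Set (Fin n → ℝ)) (y : Fin n →₀ ℕ) : Prop :=
  ∀ K : Geometry.SimplicialComplex ℝ (Fin n → ℝ), IsTriangulation Q K →
    ∀ s ∈ K.facets, pt y ∈ convexHull ℝ (s : Set (Fin n → ℝ)) →
      pt y ∈ maxMediated (s : Set (Fin n → ℝ))

end

end Agiform

/-! Agiforms are particular members of the family indexed by `C(y)`, so 1 implies 2. The work lies
in 2 ⇒ 3 and 3 ⇒ 1.

2 ⇒ 3. The barycentric coordinates of `y` in a simplex `s` of a triangulation form a `λ ∈ C(y)` that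
may have zero entries. Since `y` is interior, `C(y)` has a strictly positive point, and `λ` is a
limit of parameters of agiforms. Their Gram matrices have supports in one fixed box and bounded
entries (`IsGram.exists_bound`), so a limit array `A` exists. Wherever the coefficient of `x^(2a)`
is nonpositive, a nonzero `A a a` must be cancelled by some `A b c` with `b ≠ c` and `b + c = 2a`;
hence `2a` is the midpoint of `2b` and `2c`. The points `2a` with `A a a ≠ 0`, together with `y` and
`s`, thus form a mediated set (`mem_maxMediated_of_isGram`).

3 ⇒ 1. The good `λ` form a convex set and `C(y)` is the hull of its points with affinely independent
support (`convexCombs_subset_of_noDependency`). Such a support is a simplex that extends to a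
triangulation without new vertices, by placing the other vertices one at a time
(`exists_triangulation_extending`). By 3, `y` is mediated in a facet containing it. Each midpoint
relation in the mediated set writes one simplicial form as the average of two others plus half the
square of a binomial. This linear system has a nonnegative inverse, so all its unknowns are sums of
squares. -/

namespace Agiform

/-! ### Placing triangulations -/

section Placing

variable {E : Type*} [NormedAddCommGroup E] [NormedSpace ℝ E]

/-- The convex hull of `F` is visible from `p` with respect to `S`: moving from a point of the hull
towards `p` one leaves `S` at once. -/
def IsVisible (S : Set E) (p : E) (F : Set E) : Prop :=
  ∀ x ∈ convexHull ℝ F, ∀ τ : ℝ, 0 < τ → τ ≤ 1 → x + τ • (p - x) ∉ S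

theorem IsVisible.mono {S : Set E} {p : E} {F G : Set E} (h : IsVisible S p F) (hGF : G ⊆ F) :
    IsVisible S p G :=
  fun x hx => h x (convexHull_mono hGF hx)

/-- The barycentre of `F` is relatively interior to its hull, so if `p` were in the affine span, a
short move towards `p` would stay in `S`. This makes the cone over a visible face a simplex. -/
theorem IsVisible.notMem_affineSpan {S : Set E} {p : E} {F : Finset E}
    (h : IsVisible S p (F : Set E)) (hFS : convexHull ℝ (F : Set E) ⊆ S) :
    p ∉ affineSpan ℝ (F : Set E) := by
  intro hp
  rcases F.eq_empty_or_nonempty with rfl | hne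
  · rw [Finset.coe_empty, AffineSubspace.span_empty] at hp
    exact hp
  obtain ⟨w, hw1, hwp⟩ : ∃ w : E → ℝ, ∑ v ∈ F, w v = 1 ∧ ∑ v ∈ F, w v • v = p := by
    have hp' : p ∈ affineSpan ℝ (Set.range ((↑) : F → E)) := by simpa using hp
    obtain ⟨w, hw, rfl⟩ := eq_affineCombination_of_mem_affineSpan_of_fintype hp'
    classical
    refine ⟨fun v => if h : v ∈ F then w ⟨v, h⟩ else 0, ?_, ?_⟩
    · rw [← Finset.sum_coe_sort, ← hw]
      exact Finset.sum_congr rfl fun v _ => by simp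
    · rw [Finset.affineCombination_eq_linear_combination _ _ _ hw, ← Finset.sum_coe_sort]
      exact Finset.sum_congr rfl fun v _ => by simp
  set m : ℝ := (F.card : ℝ) with hm
  have hm0 : 0 < m := by simpa [hm] using hne.card_pos
  set W : ℝ := ∑ v ∈ F, |w v| with hW
  have hW0 : 0 ≤ W := Finset.sum_nonneg fun _ _ => abs_nonneg _
  -- Chosen so that `(1 - τ) / m = W * τ`, which absorbs every possibly negative `τ * w v`.
  set τ : ℝ := 1 / (1 + m * W) with hτ
  have hden : 0 < 1 + m * W := by positivity
  have hτ0 : 0 < τ := by positivity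
  have hτ1 : τ ≤ 1 := by
    rw [hτ, div_le_one hden]; nlinarith [mul_nonneg hm0.le hW0]
  have hsplit : (1 - τ) / m = W * τ := by
    rw [hτ]; field_simp; ring
  set x : E := ∑ v ∈ F, (1 / m) • v with hx
  have hxm : x ∈ convexHull ℝ (F : Set E) := by
    refine (convex_convexHull ℝ _).sum_mem (fun _ _ => by positivity) ?_
      (fun v hv => subset_convexHull ℝ _ hv)
    simp [← hm, hm0.ne']
  refine h x hxm τ hτ0 hτ1 (hFS ?_)
  have : x + τ • (p - x) = ∑ v ∈ F, ((1 - τ) / m + τ * w v) • v := by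
    simp only [add_smul, Finset.sum_add_distrib, mul_smul, ← Finset.smul_sum, hwp, div_eq_mul_inv]
    rw [hx]
    simp only [one_div]
    module
  rw [this]
  refine (convex_convexHull ℝ _).sum_mem (fun v hv => ?_) ?_
    (fun v hv => subset_convexHull ℝ _ hv)
  · have h1 : |w v| ≤ W := Finset.single_le_sum (f := fun v => |w v|)
      (fun _ _ => abs_nonneg _) hv
    have h2 := neg_abs_le (w v)
    rw [hsplit]
    nlinarith
  · rw [Finset.sum_add_distrib, ← Finset.mul_sum, hw1, Finset.sum_const, nsmul_eq_mul, ← hm]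
    field_simp
    ring

/-- If a point in the relative interior of a simplex sees `p`, then so does the whole simplex. -/
theorem isVisible_of_sum {S : Set E} (hS : Convex ℝ S) {p x : E} {F : Finset E}
    (hFS : convexHull ℝ (F : Set E) ⊆ S) {w : E → ℝ} (hw : ∀ v ∈ F, 0 < w v)
    (hw1 : ∑ v ∈ F, w v = 1) (hwx : ∑ v ∈ F, w v • v = x)
    (hx : ∀ τ : ℝ, 0 < τ → τ ≤ 1 → x + τ • (p - x) ∉ S) : IsVisible S p (F : Set E) := by
  intro u hu τ hτ hτ1 hmem
  obtain ⟨μ, hμ0, hμ1, hμu⟩ := Finset.mem_convexHull'.1 hu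
  have hne : F.Nonempty := by
    rw [Finset.nonempty_iff_ne_empty]; rintro rfl; simp at hw1
  obtain ⟨δ, hδ0, hδ2, hδ⟩ : ∃ δ : ℝ, 0 < δ ∧ δ ≤ 1 / 2 ∧ ∀ v ∈ F, δ ≤ w v := by
    obtain ⟨v, hv, hmin⟩ := F.exists_min_image w hne
    exact ⟨min (w v) (1 / 2), lt_min (hw v hv) (by norm_num), min_le_right _ _,
      fun u hu => (min_le_left _ _).trans (hmin u hu)⟩
  have hd1 : 0 < 1 - δ := by linarith
  set u' : E := ∑ v ∈ F, ((w v - δ * μ v) / (1 - δ)) • v with hu'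
  have hu'S : u' ∈ S := by
    refine hFS ((convex_convexHull ℝ _).sum_mem (fun v hv => ?_) ?_
      (fun v hv => subset_convexHull ℝ _ hv))
    · have : μ v ≤ 1 := hμ1 ▸ Finset.single_le_sum hμ0 hv
      have := hδ v hv
      have := hμ0 v hv
      exact div_nonneg (by nlinarith) hd1.le
    · rw [← Finset.sum_div, Finset.sum_sub_distrib, ← Finset.mul_sum, hw1, hμ1, mul_one,
        div_self hd1.ne']
  -- The relatively interior point `x` lies strictly between `u` and another point `u'` of the hull.
  have hxu : x = δ • u + (1 - δ) • u' := by
    rw [hu', Finset.smul_sum, ← hμu, Finset.smul_sum, ← hwx, ← Finset.sum_add_distrib]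
    refine Finset.sum_congr rfl fun v _ => ?_
    rw [smul_smul, smul_smul, ← add_smul, mul_div_cancel₀ _ hd1.ne']
    congr 1; ring
  have hD : 0 < 1 + δ * τ := by positivity
  -- This point on the way from `x` to `p` is the average of `u + τ • (p - u)`, `u'` and `u` with
  -- weights proportional to `δ`, `1 - δ` and `δ * τ`.
  refine hx (δ * τ / (1 + δ * τ)) (by positivity) (by rw [div_le_one hD]; linarith) ?_
  have h3 : (δ / (δ + (1 - δ) + δ * τ)) • (u + τ • (p - u)) +
      ((1 - δ) / (δ + (1 - δ) + δ * τ)) • u' +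
      (δ * τ / (δ + (1 - δ) + δ * τ)) • u ∈ S := by
    have := hS.sum_mem (t := (Finset.univ : Finset (Fin 3)))
      (w := ![δ / (δ + (1 - δ) + δ * τ), (1 - δ) / (δ + (1 - δ) + δ * τ),
        δ * τ / (δ + (1 - δ) + δ * τ)])
      (z := ![u + τ • (p - u), u', u]) ?_ ?_ ?_
    · simpa [Fin.sum_univ_three] using this
    · have hD' : 0 < δ + (1 - δ) + δ * τ := by linarith
      intro i _
      fin_cases i <;> simp <;> positivity
    · have hD' : 0 < δ + (1 - δ) + δ * τ := by linarith
      simp only [Fin.sum_univ_three, Matrix.cons_val]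
      field_simp
    · intro i _
      fin_cases i
      · exact hmem
      · exact hu'S
      · exact hFS hu
  convert h3 using 1
  have e : δ + (1 - δ) + δ * τ = 1 + δ * τ := by ring
  rw [e, hxu]
  match_scalars <;> field_simp <;> ring

theorem exists_pos_weights {F : Finset E} {x : E} (hx : x ∈ convexHull ℝ (F : Set E)) :
    ∃ G ⊆ F, ∃ w : E → ℝ, (∀ v ∈ G, 0 < w v) ∧ ∑ v ∈ G, w v = 1 ∧ ∑ v ∈ G, w v • v = x := by
  classical
  obtain ⟨w, hw0, hw1, hwx⟩ := Finset.mem_convexHull'.1 hx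
  have hz : ∀ v ∈ F, v ∉ F.filter (fun v => 0 < w v) → w v = 0 := fun v hv h =>
    le_antisymm (not_lt.1 fun h' => h (Finset.mem_filter.2 ⟨hv, h'⟩)) (hw0 v hv)
  refine ⟨F.filter (fun v => 0 < w v), Finset.filter_subset _ _, w,
    fun v hv => (Finset.mem_filter.1 hv).2, ?_, ?_⟩
  · rw [← hw1]
    exact Finset.sum_subset (Finset.filter_subset _ _) hz
  · rw [← hwx]
    exact Finset.sum_subset (Finset.filter_subset _ _) fun v hv h => by rw [hz v hv h, zero_smul]

/-- The separate case `z = p` is needed only for empty `F`. -/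
theorem mem_convexHull_insert_iff {F : Set E} {p z : E} :
    z ∈ convexHull ℝ (insert p F) ↔
      z = p ∨ ∃ x ∈ convexHull ℝ F, ∃ τ : ℝ, 0 ≤ τ ∧ τ ≤ 1 ∧ z = x + τ • (p - x) := by
  rcases F.eq_empty_or_nonempty with rfl | hne
  · simp
  rw [convexHull_insert hne, convexJoin_comm, mem_convexJoin]
  constructor
  · rintro ⟨x, hx, q, rfl, hz⟩
    rw [segment_eq_image'] at hz
    obtain ⟨τ, hτ, rfl⟩ := hz
    exact Or.inr ⟨x, hx, τ, hτ.1, hτ.2, rfl⟩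
  · rintro (rfl | ⟨x, hx, τ, h0, h1, rfl⟩)
    · obtain ⟨x, hx⟩ := hne
      exact ⟨x, subset_convexHull ℝ _ hx, z, rfl, right_mem_segment _ _ _⟩
    · refine ⟨x, hx, p, rfl, ?_⟩
      rw [segment_eq_image']
      exact ⟨τ, ⟨h0, h1⟩, rfl⟩

/-- If two segments ending at `p` meet before `p`, one starting point lies on the other segment, and
visibility forbids a proper displacement. Hence cones over visible faces meet only over common base
points. -/
theorem eq_of_ray_le {S : Set E} {p x x' : E} {a b : ℝ} (hb : b < 1) (hab : a ≤ b)
    (h : x + a • (p - x) = x' + b • (p - x')) (hx : x ∈ S)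
    (hx' : ∀ τ : ℝ, 0 < τ → τ ≤ 1 → x' + τ • (p - x') ∉ S) : x = x' := by
  have h1 : 0 < 1 - a := by linarith
  have key : x = x' + ((b - a) / (1 - a)) • (p - x') := by
    have h2 : (1 - a) • x = (1 - a) • (x' + ((b - a) / (1 - a)) • (p - x')) := by
      have e1 : (1 - a) • x = (x + a • (p - x)) - a • p := by module
      rw [e1, h, smul_add, smul_smul, mul_div_cancel₀ _ h1.ne']
      module
    exact smul_right_injective E h1.ne' h2
  rcases hab.eq_or_lt with rfl | hlt
  · simpa using key
  · refine absurd (key ▸ hx) (hx' _ (div_pos (by linarith) h1) ?_)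
    rw [div_le_one h1]; linarith

open Classical in
/-- Add the cones with apex `p` over the visible faces of a simplicial complex. -/
def placing (K : Geometry.SimplicialComplex ℝ E) (p : E) (hp : p ∉ K.space) :
    Geometry.SimplicialComplex ℝ E where
  -- The choice `G = ∅`, vacuously visible, contributes the vertex `{p}`.
  faces := K.faces ∪
    {s | ∃ G : Finset E, (G = ∅ ∨ G ∈ K.faces) ∧ IsVisible K.space p (G : Set E) ∧ s = insert p G}
  isRelLowerSet_faces := by
    rintro s (hs | ⟨G, hG, hvis, rfl⟩)
    · refine ⟨K.nonempty_of_mem_faces hs, fun t hts ht => Or.inl (K.down_closed hs hts ht)⟩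
    · refine ⟨Finset.insert_nonempty _ _, fun t hts ht => ?_⟩
      have hsub : t.erase p ⊆ G := Finset.subset_insert_iff.1 hts
      have hface : ∀ t : Finset E, t ⊆ G → t = ∅ ∨ t ∈ K.faces := by
        intro t ht
        rcases t.eq_empty_or_nonempty with h | h
        · exact Or.inl h
        · rcases hG with rfl | hG
          · exact Or.inl (Finset.subset_empty.1 ht)
          · exact Or.inr (K.down_closed hG ht h)
      by_cases hpt : p ∈ t
      · exact Or.inr ⟨t.erase p, hface _ hsub, hvis.mono (by exact_mod_cast hsub),
          (Finset.insert_erase hpt).symm⟩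
      · rw [Finset.erase_eq_of_notMem hpt] at hsub
        exact Or.inl ((hface t hsub).resolve_left ht.ne_empty)
  indep := by
    rintro s (hs | ⟨G, hG, hvis, rfl⟩)
    · exact K.indep hs
    · have hGS : convexHull ℝ (G : Set E) ⊆ K.space := by
        rcases hG with rfl | hG
        · simp
        · exact K.convexHull_subset_space hG
      have hind : AffineIndependent ℝ (fun x : G => (x : E)) := by
        rcases hG with rfl | hG
        · have : Subsingleton (∅ : Finset E) := ⟨fun x => absurd x.2 (Finset.notMem_empty _)⟩
          exact affineIndependent_of_subsingleton _ _
        · exact K.indep hG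
      have hmem : ∀ x : (insert p G : Finset E), x ≠ ⟨p, Finset.mem_insert_self _ _⟩ →
          (x : E) ∈ G := fun x hx =>
        (Finset.mem_insert.1 x.2).resolve_left fun h => hx (Subtype.ext h)
      refine AffineIndependent.affineIndependent_of_notMem_span
        (i := ⟨p, Finset.mem_insert_self _ _⟩) ?_ fun h => ?_
      · let f : {x : (insert p G : Finset E) // x ≠ ⟨p, Finset.mem_insert_self _ _⟩} ↪ G :=
          ⟨fun x => ⟨x, hmem x x.2⟩, fun x y h => Subtype.ext (Subtype.ext (by simpa using h))⟩
        exact hind.comp_embedding f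
      · refine hvis.notMem_affineSpan hGS (affineSpan_mono ℝ ?_ h)
        rintro _ ⟨x, hx, rfl⟩
        exact hmem x hx
  inter_subset_convexHull := by
    -- Off its base a visible cone misses `K.space`, so it meets an old face only inside the base.
    have hmixed : ∀ G s : Finset E, (G = ∅ ∨ G ∈ K.faces) → IsVisible K.space p (G : Set E) →
        s ∈ K.faces → convexHull ℝ (insert p G : Finset E) ∩ convexHull ℝ (s : Set E) ⊆
          convexHull ℝ (((insert p G : Finset E) : Set E) ∩ s) := by
      rintro G s hG hvis hs z ⟨hz1, hz2⟩
      have hzS := K.convexHull_subset_space hs hz2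
      rw [Finset.coe_insert, mem_convexHull_insert_iff] at hz1
      rcases hz1 with rfl | ⟨x, hx, τ, h0, h1, rfl⟩
      · exact absurd hzS hp
      rcases hG with rfl | hG
      · simp at hx
      rcases h0.eq_or_lt with rfl | h0
      · rw [zero_smul, add_zero] at hz2 ⊢
        refine convexHull_mono ?_ (K.inter_subset_convexHull hG hs ⟨hx, hz2⟩)
        exact Set.inter_subset_inter_left _ (by simp)
      · exact absurd hzS (hvis x hx τ h0 h1)
    rintro s t (hs | ⟨G, hG, hGvis, rfl⟩) (ht | ⟨H, hH, hHvis, rfl⟩)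
    · exact K.inter_subset_convexHull hs ht
    · rw [Set.inter_comm, Set.inter_comm (s : Set E)]
      exact hmixed H s hH hHvis hs
    · exact hmixed G t hG hGvis ht
    · rintro z ⟨hz1, hz2⟩
      have hpp : p ∈ (((insert p G : Finset E) : Set E) ∩ (insert p H : Finset E)) := by simp
      rw [Finset.coe_insert, mem_convexHull_insert_iff] at hz1 hz2
      by_cases hzp : z = p
      · rw [hzp]; exact subset_convexHull ℝ _ hpp
      obtain ⟨x, hx, a, ha0, ha1, hza⟩ := hz1.resolve_left hzp
      obtain ⟨x', hx', b, hb0, hb1, hzb⟩ := hz2.resolve_left hzp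
      have ha1 : a < 1 := ha1.lt_of_ne fun h => hzp (by rw [hza, h]; simp)
      have hb1 : b < 1 := hb1.lt_of_ne fun h => hzp (by rw [hzb, h]; simp)
      have hG' : G ∈ K.faces := hG.resolve_left (by rintro rfl; simp at hx)
      have hH' : H ∈ K.faces := hH.resolve_left (by rintro rfl; simp at hx')
      have hxx : x = x' := by
        rcases le_total a b with hab | hab
        · exact eq_of_ray_le hb1 hab (hza.symm.trans hzb)
            (K.convexHull_subset_space hG' hx) (hHvis x' hx')
        · exact (eq_of_ray_le ha1 hab (hzb.symm.trans hza)
            (K.convexHull_subset_space hH' hx') (hGvis x hx)).symm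
      subst hxx
      have hxI := K.inter_subset_convexHull hG' hH' ⟨hx, hx'⟩
      have : z ∈ convexHull ℝ (insert p ((G : Set E) ∩ H)) :=
        mem_convexHull_insert_iff.2 (Or.inr ⟨x, hxI, a, ha0, ha1.le, hza⟩)
      simpa [Set.insert_inter_distrib] using this

/-- To cover the new hull, follow the segment from `x` to `p` up to its last point in the compact
convex set `K.space`. Earlier points lie in `K.space`; later ones lie in the cone over the face
having that last point in its relative interior, and this face is visible by `isVisible_of_sum`. -/
theorem placing_space (K : Geometry.SimplicialComplex ℝ E) (p : E) (hp : p ∉ K.space)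
    {A : Finset E} (hA : K.space = convexHull ℝ (A : Set E)) :
    (placing K p hp).space = convexHull ℝ (insert p (A : Set E)) := by
  classical
  have hconv : Convex ℝ K.space := hA ▸ convex_convexHull ℝ _
  have hcomp : IsCompact K.space := hA ▸ A.finite_toSet.isCompact_convexHull ℝ
  have hle : K.space ⊆ convexHull ℝ (insert p (A : Set E)) := by
    rw [hA]; exact convexHull_mono (Set.subset_insert _ _)
  have hpA : p ∈ convexHull ℝ (insert p (A : Set E)) :=
    subset_convexHull ℝ _ (Set.mem_insert _ _)
  refine Set.Subset.antisymm ?_ ?_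
  · refine Set.iUnion₂_subset ?_
    rintro s (hs | ⟨G, hG, -, rfl⟩)
    · exact (K.convexHull_subset_space hs).trans hle
    · refine convexHull_min ?_ (convex_convexHull ℝ _)
      rw [Finset.coe_insert]
      refine Set.insert_subset hpA ?_
      rcases hG with rfl | hG
      · simp
      · exact (K.subset_space hG).trans hle
  · have hold : K.space ⊆ (placing K p hp).space :=
      Set.biUnion_subset_biUnion_left (fun s hs => Or.inl hs)
    intro z hz
    rw [mem_convexHull_insert_iff, ← hA] at hz
    rcases hz with rfl | ⟨x, hx, τ, h0, h1, rfl⟩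
    · refine Geometry.SimplicialComplex.mem_space_iff.2 ⟨{z}, Or.inr ⟨∅, Or.inl rfl, ?_, by simp⟩,
        by simp⟩
      intro x hx
      simp at hx
    · set T : Set ℝ := Set.Icc 0 1 ∩ (fun σ : ℝ => x + σ • (p - x)) ⁻¹' K.space with hT
      have hTc : IsCompact T := isCompact_Icc.inter_right
        (hcomp.isClosed.preimage (by fun_prop))
      obtain ⟨σ, ⟨⟨hσ0, hσ1⟩, hσS⟩, hmax⟩ := hTc.exists_isGreatest ⟨0, by simp [hT, hx]⟩
      rcases le_or_gt τ σ with hle' | hlt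
      · apply hold
        rcases h0.eq_or_lt with rfl | h0
        · simpa using hx
        have hσpos : 0 < σ := h0.trans_le hle'
        have : x + τ • (p - x) = x + (τ / σ) • ((x + σ • (p - x)) - x) := by
          rw [add_sub_cancel_left, smul_smul, div_mul_cancel₀ _ hσpos.ne']
        rw [this]
        exact hconv.add_smul_sub_mem hx hσS ⟨by positivity, (div_le_one hσpos).2 hle'⟩
      · set x' : E := x + σ • (p - x) with hx'
        have hσlt : σ < 1 := hlt.trans_le h1
        have hσp : 0 < 1 - σ := by linarith
        have hvis : ∀ ρ : ℝ, 0 < ρ → ρ ≤ 1 → x' + ρ • (p - x') ∉ K.space := by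
          intro ρ hρ0 hρ1 hmem
          have e : x' + ρ • (p - x') = x + (σ + ρ * (1 - σ)) • (p - x) := by
            rw [hx']; module
          rw [e] at hmem
          have := hmax ⟨⟨by positivity, by nlinarith⟩, hmem⟩
          nlinarith
        obtain ⟨F, hF, hxF⟩ := Geometry.SimplicialComplex.mem_space_iff.1 hσS
        obtain ⟨G, hGF, w, hw0, hw1, hwx⟩ := exists_pos_weights hxF
        have hGne : G.Nonempty := by
          rw [Finset.nonempty_iff_ne_empty]; rintro rfl; simp at hw1
        have hG := K.down_closed hF hGF hGne
        refine Geometry.SimplicialComplex.mem_space_iff.2 ⟨insert p G, Or.inr ⟨G, Or.inr hG,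
          isVisible_of_sum hconv (K.convexHull_subset_space hG) hw0 hw1 hwx hvis, rfl⟩, ?_⟩
        rw [Finset.coe_insert, mem_convexHull_insert_iff]
        refine Or.inr ⟨x', ?_, (τ - σ) / (1 - σ), div_nonneg (by linarith) hσp.le,
          (div_le_one hσp).2 (by linarith), ?_⟩
        · rw [show x' = _ from hwx.symm]
          exact (convex_convexHull ℝ _).sum_mem (fun v hv => (hw0 v hv).le) hw1
            (fun v hv => subset_convexHull ℝ _ hv)
        · have e : p - x' = (1 - σ) • (p - x) := by rw [hx']; module
          rw [e, smul_smul, div_mul_cancel₀ _ hσp.ne', hx']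
          module

theorem placing_vertices (K : Geometry.SimplicialComplex ℝ E) (p : E) (hp : p ∉ K.space) :
    (placing K p hp).vertices ⊆ insert p K.vertices := by
  classical
  intro x hx
  rcases hx with hx | ⟨G, -, -, h⟩
  · exact Or.inr hx
  · left
    have : p ∈ ({x} : Finset E) := h ▸ Finset.mem_insert_self _ _
    exact (Finset.mem_singleton.1 this).symm

/-- The complex of all faces of a simplex. -/
def simplexComplex (t : Finset E) (ht : AffineIndependent ℝ ((↑) : t → E)) :
    Geometry.SimplicialComplex ℝ E where
  faces := {s | s ⊆ t ∧ s.Nonempty}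
  isRelLowerSet_faces := fun _ hs => ⟨hs.2, fun _ hts hu => ⟨hts.trans hs.1, hu⟩⟩
  indep := fun hs => ht.mono (by exact_mod_cast hs.1)
  inter_subset_convexHull := by
    classical
    intro s u hs hu
    rw [ht.convexHull_inter hs.1 hu.1]

/-- Points in convex position have a triangulation that contains a given simplex. -/
theorem exists_triangulation_extending (A t : Finset E) (htA : t ⊆ A) (hne : t.Nonempty)
    (ht : AffineIndependent ℝ ((↑) : t → E))
    (hA : ∀ p ∈ A, ∀ B ⊆ A, p ∈ convexHull ℝ (B : Set E) → p ∈ B) :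
    ∃ K : Geometry.SimplicialComplex ℝ E, K.space = convexHull ℝ (A : Set E) ∧
      K.vertices ⊆ A ∧ t ∈ K.faces := by
  classical
  suffices h : ∀ B : Finset E, B ⊆ A → ∃ K : Geometry.SimplicialComplex ℝ E,
      K.space = convexHull ℝ ((t ∪ B : Finset E) : Set E) ∧ K.vertices ⊆ (t ∪ B : Finset E) ∧
        t ∈ K.faces by
    simpa [Finset.union_eq_right.2 htA] using h A subset_rfl
  intro B
  induction B using Finset.induction_on with
  | empty =>
    intro _
    refine ⟨simplexComplex t ht, ?_, fun x hx => by simpa using hx.1, subset_rfl, hne⟩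
    rw [Finset.union_empty]
    refine Set.Subset.antisymm (Set.iUnion₂_subset fun s hs => ?_) ?_
    · exact convexHull_mono (by exact_mod_cast hs.1)
    · exact Geometry.SimplicialComplex.convexHull_subset_space (K := simplexComplex t ht)
        ⟨subset_rfl, hne⟩
  | insert p B hpB ih =>
    intro hins
    obtain ⟨K, hsp, hv, htK⟩ := ih ((Finset.subset_insert _ _).trans hins)
    have hBA : t ∪ B ⊆ A := Finset.union_subset htA ((Finset.subset_insert _ _).trans hins)
    rw [Finset.union_insert]
    by_cases hp : p ∈ t ∪ B
    · rw [Finset.insert_eq_of_mem hp]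
      exact ⟨K, hsp, hv, htK⟩
    -- Convex position keeps the next point outside the hull built so far.
    · have hpS : p ∉ K.space := fun h =>
        hp (hA p (hins (Finset.mem_insert_self _ _)) _ hBA (hsp ▸ h))
      refine ⟨placing K p hpS, ?_, ?_, Or.inl htK⟩
      · rw [placing_space K p hpS hsp, Finset.coe_insert]
      · rw [Finset.coe_insert]
        exact (placing_vertices K p hpS).trans (Set.insert_subset_insert hv)

theorem exists_facet_superset {K : Geometry.SimplicialComplex ℝ E} {A : Finset E}
    (hA : K.vertices ⊆ A) {t : Finset E} (ht : t ∈ K.faces) : ∃ s ∈ K.facets, t ⊆ s := by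
  have hfin : K.faces.Finite := by
    refine (Finset.finite_toSet A.powerset).subset fun s hs => ?_
    rw [Finset.mem_coe, Finset.mem_powerset]
    intro x hx
    exact hA (K.down_closed hs (Finset.singleton_subset_iff.2 hx) (Finset.singleton_nonempty _))
  obtain ⟨s, hts, hs⟩ := hfin.exists_le_maximal ht
  exact ⟨s, ⟨hs.prop, fun u hu hsu => hs.eq_of_le hu hsu⟩, hts⟩

end Placing

/-! ### Extremal principle for midpoint-closed sets -/

/-- An extreme point of the hull of `L` lies in `L` and is no midpoint of two distinct points of
`L`, so it lies in `D`; Krein–Milman concludes. With `D = ∅` this forces `L` to be empty. -/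
theorem subset_convexHull_of_midpoints {E : Type*} [NormedAddCommGroup E] [NormedSpace ℝ E]
    {D L : Set E} (hL : L.Finite)
    (h : ∀ x ∈ L, x ∉ D → ∃ s ∈ L, ∃ t ∈ L, s ≠ t ∧ x = (1 / 2 : ℝ) • (s + t)) :
    L ⊆ convexHull ℝ D := by
  have hext : (convexHull ℝ L).extremePoints ℝ ⊆ D ∩ L := by
    intro x hx
    have hxL := extremePoints_convexHull_subset hx
    refine ⟨by_contra fun hxD => ?_, hxL⟩
    obtain ⟨s, hs, t, ht, hst, rfl⟩ := h x hxL hxD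
    have hmid : (1 / 2 : ℝ) • (s + t) ∈ openSegment ℝ s t :=
      ⟨1 / 2, 1 / 2, by norm_num, by norm_num, by norm_num, by rw [smul_add]⟩
    obtain ⟨h1, h2⟩ := (mem_extremePoints.1 hx).2 s (subset_convexHull ℝ _ hs) t
      (subset_convexHull ℝ _ ht) hmid
    exact hst (h1.trans h2.symm)
  have hfin : ((convexHull ℝ L).extremePoints ℝ).Finite :=
    hL.subset fun x hx => (hext hx).2
  have hKM := closure_convexHull_extremePoints (hL.isCompact_convexHull ℝ) (convex_convexHull ℝ L)
  rw [(hfin.isCompact_convexHull ℝ).isClosed.closure_eq] at hKM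
  intro x hx
  have : x ∈ convexHull ℝ ((convexHull ℝ L).extremePoints ℝ) := hKM.symm ▸ subset_convexHull ℝ L hx
  exact convexHull_mono (fun z hz => (hext hz).1) this

/-! ### Exponent vectors and coefficients -/

section Exponents

variable {n : ℕ}

theorem pt_injective : Function.Injective (pt (n := n)) := by
  intro a b h
  ext i
  exact Nat.cast_injective (R := ℝ) (congrFun h i)

theorem pt_add (a b : Fin n →₀ ℕ) : pt (a + b) = pt a + pt b := by
  ext i; simp [pt]

theorem isLatticePoint_pt (a : Fin n →₀ ℕ) : IsLatticePoint (pt a) :=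
  fun i => ⟨a i, by simp [pt]⟩

theorem isEvenPoint_pt_add_self (a : Fin n →₀ ℕ) : IsEvenPoint (pt (a + a)) :=
  fun i => ⟨a i, by simp [pt]; ring⟩

theorem add_self_injective {a b : Fin n →₀ ℕ} (h : a + a = b + b) : a = b := by
  ext i
  have := DFunLike.congr_fun h i
  simp only [Finsupp.add_apply] at this
  lia

theorem coeff_poly (V : Finset (Fin n →₀ ℕ)) (l : V → ℝ) (y w : Fin n →₀ ℕ) :
    (poly V l y).coeff w = (if h : w ∈ V then l ⟨w, h⟩ else 0) - if w = y then 1 else 0 := by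
  classical
  rw [poly, MvPolynomial.coeff_sub, MvPolynomial.coeff_sum, MvPolynomial.coeff_monomial]
  congr 1
  · simp only [MvPolynomial.coeff_monomial]
    split_ifs with h
    · rw [Finset.sum_eq_single ⟨w, h⟩]
      · simp
      · intro b _ hb
        exact if_neg fun h' => hb (Subtype.ext h')
      · simp
    · exact Finset.sum_eq_zero fun v _ => if_neg fun h' : (v : Fin n →₀ ℕ) = w => h (h' ▸ v.2)
  · simp only [eq_comm]

theorem le_sup_of_pt_mem_convexHull {V : Finset (Fin n →₀ ℕ)} {a : Fin n →₀ ℕ}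
    (h : pt a ∈ convexHull ℝ (pt '' (V : Set (Fin n →₀ ℕ)))) : a ≤ V.sup id := by
  intro i
  have hc : Convex ℝ {x : Fin n → ℝ | x i ≤ pt (V.sup id) i} :=
    convex_halfSpace_le (f := fun x : Fin n → ℝ => x i) ⟨fun _ _ => rfl, fun _ _ => rfl⟩ _
  have := convexHull_min (s := pt '' (V : Set (Fin n →₀ ℕ))) ?_ hc h
  · simpa [pt] using this
  · rintro _ ⟨v, hv, rfl⟩
    have : v ≤ V.sup id := Finset.le_sup (f := id) hv
    simpa [pt] using this i

end Exponents

/-! ### Gram arrays: midpoints, bounds and limits -/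

section Gram

variable {n : ℕ}

/-- A representation of the coefficients of `f` by a symmetric-form-like array whose `2 × 2` minors
are nonnegative, as provided by a Gram matrix of `f`. -/
structure IsGram (A : (Fin n →₀ ℕ) → (Fin n →₀ ℕ) → ℝ) (f : MvPolynomial (Fin n) ℝ) : Prop where
  nonneg : ∀ a, 0 ≤ A a a
  sq_le : ∀ a b, A a b ^ 2 ≤ A a a * A b b
  coeff_eq : ∀ w, f.coeff w = ∑ p ∈ Finset.HasAntidiagonal.antidiagonal w, A p.1 p.2

variable {A : (Fin n →₀ ℕ) → (Fin n →₀ ℕ) → ℝ} {f : MvPolynomial (Fin n) ℝ}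

theorem IsGram.diag_ne_zero (hA : IsGram A f) {b c : Fin n →₀ ℕ} (h : A b c ≠ 0) :
    A b b ≠ 0 ∧ A c c ≠ 0 := by
  have h1 := hA.sq_le b c
  have h2 : 0 < A b c ^ 2 := by positivity
  constructor <;> intro h0 <;> rw [h0] at h1 <;> linarith

/-- The positive `A a a` must be cancelled by an off-diagonal entry, and the `2 × 2` minors make
both diagonal entries belonging to it nonzero. -/
theorem IsGram.exists_midpoint (hA : IsGram A f) {a : Fin n →₀ ℕ} (ha : A a a ≠ 0)
    (hf : f.coeff (a + a) ≤ 0) :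
    ∃ b c, b ≠ c ∧ b + c = a + a ∧ A b b ≠ 0 ∧ A c c ≠ 0 := by
  by_contra! hno
  rw [hA.coeff_eq, Finset.sum_eq_single (a, a)] at hf
  · exact ha (le_antisymm hf (hA.nonneg a))
  · rintro ⟨b, c⟩ hp hne
    rw [Finset.HasAntidiagonal.mem_antidiagonal] at hp
    by_contra h0
    obtain ⟨hb, hc⟩ := hA.diag_ne_zero h0
    by_cases hbc : b = c
    · subst hbc
      exact hne (Prod.ext (add_self_injective hp) (add_self_injective hp))
    · exact hc (hno b c hbc hp hb)
  · simp

theorem IsGram.exists_of_coeff_neg (hA : IsGram A f) {y : Fin n →₀ ℕ} (hf : f.coeff y < 0) :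
    ∃ b c, b ≠ c ∧ b + c = y ∧ A b b ≠ 0 ∧ A c c ≠ 0 := by
  rw [hA.coeff_eq] at hf
  obtain ⟨⟨b, c⟩, hp, hneg⟩ : ∃ p ∈ Finset.HasAntidiagonal.antidiagonal y, A p.1 p.2 < 0 := by
    by_contra! h
    exact hf.not_ge (Finset.sum_nonneg h)
  obtain ⟨hb, hc⟩ := hA.diag_ne_zero hneg.ne
  refine ⟨b, c, ?_, Finset.HasAntidiagonal.mem_antidiagonal.1 hp, hb, hc⟩
  rintro rfl
  exact hneg.not_ge (hA.nonneg b)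

theorem exists_sum_mul_self_of_isSumSq {R : Type*} [CommSemiring R] {f : R} (hf : IsSumSq f) :
    ∃ (m : ℕ) (h : Fin m → R), f = ∑ i, h i * h i := by
  induction hf with
  | zero => exact ⟨0, Fin.elim0, by simp⟩
  | sq_add a _ ih =>
    obtain ⟨m, h, rfl⟩ := ih
    exact ⟨m + 1, Fin.cons a h, by simp [Fin.sum_univ_succ]⟩

theorem exists_isGram (hf : IsSumSq f) : ∃ A, IsGram A f ∧ {a | A a a ≠ 0}.Finite := by
  obtain ⟨m, h, rfl⟩ := exists_sum_mul_self_of_isSumSq hf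
  refine ⟨fun a b => ∑ i, (h i).coeff a * (h i).coeff b, ⟨fun a => ?_, fun a b => ?_, fun w => ?_⟩,
    ?_⟩
  · exact Finset.sum_nonneg fun i _ => mul_self_nonneg _
  · simpa only [pow_two] using Finset.sum_mul_sq_le_sq_mul_sq Finset.univ
      (fun i => (h i).coeff a) (fun i => (h i).coeff b)
  · rw [MvPolynomial.coeff_sum, Finset.sum_comm]
    exact Finset.sum_congr rfl fun i _ => MvPolynomial.coeff_mul _ _ _
  · refine (Set.finite_iUnion fun i => (h i).support.finite_toSet).subset fun a ha => ?_
    obtain ⟨i, -, hi⟩ := Finset.exists_ne_zero_of_sum_ne_zero ha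
    exact Set.mem_iUnion.2 ⟨i, MvPolynomial.mem_support_iff.2 (left_ne_zero_of_mul hi)⟩

/-- The squared Euclidean length of an exponent vector. -/
def sqLength (a : Fin n →₀ ℕ) : ℕ := ∑ i, a i ^ 2

/-- By the parallelogram law the two sides without the `2` differ by twice the squared length of `b
- c`. -/
theorem two_mul_sqLength_add_lt {b c : Fin n →₀ ℕ} (h : b ≠ c) :
    2 * sqLength (b + c) + 2 ≤ sqLength (b + b) + sqLength (c + c) := by
  have h4 : ∀ a : Fin n →₀ ℕ, sqLength (a + a) = 4 * sqLength a := fun a => by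
    simp only [sqLength, Finset.mul_sum]
    exact Finset.sum_congr rfl fun i _ => by rw [Finsupp.add_apply]; ring
  have hlt : sqLength (b + c) < 2 * (sqLength b + sqLength c) := by
    obtain ⟨i, hi⟩ := DFunLike.ne_iff.1 h
    simp only [sqLength, ← Finset.sum_add_distrib, Finset.mul_sum, Finsupp.add_apply]
    refine Finset.sum_lt_sum (fun j _ => ?_) ⟨i, Finset.mem_univ _, ?_⟩
    · zify; nlinarith [sq_nonneg ((b j : ℤ) - c j)]
    · zify
      have : (b i : ℤ) - c i ≠ 0 := sub_ne_zero.2 (by exact_mod_cast hi)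
      have : 0 < ((b i : ℤ) - c i) ^ 2 := by positivity
      nlinarith
  rw [h4, h4]
  lia

/-- Maximise the weighted diagonal `A a a * T ^ sqLength (a + a)`. At a maximiser, strict convexity
of the squared length and the minors give `|A b c| * T ≤ A a a` whenever `b + c = a + a`, `b ≠ c`.
There are at most `N` such pairs, so `T = 2 * N + 1` bounds their total by `A a a / 2`. As the
coefficient is at most `1`, `A a a ≤ 2`, and maximality bounds all other diagonal entries. -/
theorem IsGram.exists_bound (P : Finset (Fin n →₀ ℕ)) :
    ∃ C : ℝ, ∀ (A : (Fin n →₀ ℕ) → (Fin n →₀ ℕ) → ℝ) (f : MvPolynomial (Fin n) ℝ), IsGram A f →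
      (∀ a, a ∉ P → A a a = 0) → (∀ w, f.coeff w ≤ 1) → ∀ a, A a a ≤ C := by
  classical
  obtain ⟨N, hN⟩ : ∃ N : ℕ, ∀ a ∈ P, (Finset.HasAntidiagonal.antidiagonal (a + a)).card ≤ N :=
    ⟨_, fun a ha => Finset.le_sup (f := fun a : Fin n →₀ ℕ =>
      (Finset.HasAntidiagonal.antidiagonal (a + a)).card) ha⟩
  obtain ⟨M, hM⟩ : ∃ M : ℕ, ∀ a ∈ P, sqLength (a + a) ≤ M :=
    ⟨_, fun a ha => Finset.le_sup (f := fun a : Fin n →₀ ℕ => sqLength (a + a)) ha⟩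
  obtain ⟨T, hT⟩ : ∃ T : ℝ, T = 2 * N + 1 := ⟨_, rfl⟩
  have hT1 : 1 ≤ T := by rw [hT]; linarith [Nat.cast_nonneg (α := ℝ) N]
  have hT0 : 0 < T := by linarith
  refine ⟨2 * T ^ M, fun A f hA hP hf => ?_⟩
  rcases P.eq_empty_or_nonempty with rfl | hne
  · intro a
    rw [hP a (Finset.notMem_empty a)]
    positivity
  obtain ⟨a, ha, hmax⟩ := P.exists_max_image (fun a => A a a * T ^ sqLength (a + a)) hne
  obtain ⟨X, hX⟩ : ∃ X : ℝ, X = A a a * T ^ sqLength (a + a) := ⟨_, rfl⟩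
  rw [← hX] at hmax
  have hX0 : 0 ≤ X := hX ▸ mul_nonneg (hA.nonneg a) (by positivity)
  have hle : ∀ b, A b b * T ^ sqLength (b + b) ≤ X := fun b => by
    by_cases hb : b ∈ P
    · exact hmax b hb
    · rw [hP b hb, zero_mul]; exact hX0
  have hoff : ∀ b c, b ≠ c → b + c = a + a → |A b c| * T ≤ A a a := by
    intro b c hbc hsum
    have h1 : A b c ^ 2 * T ^ (sqLength (b + b) + sqLength (c + c)) ≤ X * X := by
      calc A b c ^ 2 * T ^ (sqLength (b + b) + sqLength (c + c))
          ≤ (A b b * A c c) * T ^ (sqLength (b + b) + sqLength (c + c)) :=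
            mul_le_mul_of_nonneg_right (hA.sq_le b c) (by positivity)
        _ = (A b b * T ^ sqLength (b + b)) * (A c c * T ^ sqLength (c + c)) := by
            rw [pow_add]; ring
        _ ≤ X * X := mul_le_mul (hle b) (hle c)
            (mul_nonneg (hA.nonneg c) (by positivity)) hX0
    have h2 : T ^ (2 * sqLength (a + a) + 2) ≤ T ^ (sqLength (b + b) + sqLength (c + c)) :=
      pow_le_pow_right₀ hT1 (hsum ▸ two_mul_sqLength_add_lt hbc)
    have h3 : (|A b c| * T) ^ 2 * T ^ (2 * sqLength (a + a)) ≤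
        A a a ^ 2 * T ^ (2 * sqLength (a + a)) := by
      calc (|A b c| * T) ^ 2 * T ^ (2 * sqLength (a + a))
          = A b c ^ 2 * T ^ (2 * sqLength (a + a) + 2) := by rw [mul_pow, sq_abs, pow_add]; ring
        _ ≤ A b c ^ 2 * T ^ (sqLength (b + b) + sqLength (c + c)) :=
            mul_le_mul_of_nonneg_left h2 (sq_nonneg _)
        _ ≤ X * X := h1
        _ = A a a ^ 2 * T ^ (2 * sqLength (a + a)) := by rw [hX, pow_mul']; ring
    exact le_of_sq_le_sq (le_of_mul_le_mul_right h3 (by positivity)) (hA.nonneg a)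
  have ha2 : A a a ≤ 2 := by
    have hco := hA.coeff_eq (a + a)
    rw [← Finset.add_sum_erase _ _ (Finset.HasAntidiagonal.mem_antidiagonal.2 (rfl : (a, a).1 + (a, a).2 = a + a))]
      at hco
    have hsum : -(∑ p ∈ (Finset.HasAntidiagonal.antidiagonal (a + a)).erase (a, a), A p.1 p.2) ≤
        N * (A a a / T) := by
      rw [← Finset.sum_neg_distrib]
      calc ∑ p ∈ (Finset.HasAntidiagonal.antidiagonal (a + a)).erase (a, a), -A p.1 p.2
          ≤ ∑ p ∈ (Finset.HasAntidiagonal.antidiagonal (a + a)).erase (a, a), A a a / T := by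
            refine Finset.sum_le_sum fun p hp => ?_
            obtain ⟨hpne, hp⟩ := Finset.mem_erase.1 hp
            rw [Finset.HasAntidiagonal.mem_antidiagonal] at hp
            rw [le_div_iff₀ hT0]
            refine le_trans ?_ (hoff p.1 p.2 (fun h => hpne ?_) hp)
            · exact mul_le_mul_of_nonneg_right (neg_le_abs _) hT0.le
            · have : p.1 = a := add_self_injective (by rw [← hp, ← h])
              exact Prod.ext this (h ▸ this)
        _ = ((Finset.HasAntidiagonal.antidiagonal (a + a)).erase (a, a)).card * (A a a / T) := by
            rw [Finset.sum_const, nsmul_eq_mul]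
        _ ≤ N * (A a a / T) := by
            refine mul_le_mul_of_nonneg_right ?_ (div_nonneg (hA.nonneg a) hT0.le)
            have h1 : ((Finset.HasAntidiagonal.antidiagonal (a + a)).erase (a, a)).card ≤
                (Finset.HasAntidiagonal.antidiagonal (a + a)).card := Finset.card_erase_le
            exact_mod_cast h1.trans (hN a ha)
    have hhalf : N * (A a a / T) ≤ A a a / 2 := by
      rw [mul_div_assoc', div_le_div_iff₀ hT0 two_pos]
      nlinarith [hA.nonneg a]
    have := hf (a + a)
    linarith
  intro b
  by_cases hb : b ∈ P
  · calc A b b = A b b * 1 := (mul_one _).symm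
      _ ≤ A b b * T ^ sqLength (b + b) :=
        mul_le_mul_of_nonneg_left (one_le_pow₀ hT1) (hA.nonneg b)
      _ ≤ X := hle b
      _ ≤ 2 * T ^ M := hX ▸
        mul_le_mul ha2 (pow_le_pow_right₀ hT1 (hM a ha)) (by positivity) two_pos.le
  · rw [hP b hb]; positivity

open Filter Topology in
/-- Gram arrays with bounded support persist in the limit. -/
theorem IsGram.exists_of_tendsto (P : Finset (Fin n →₀ ℕ)) {F : ℕ → MvPolynomial (Fin n) ℝ}
    (hF : ∀ k, ∃ A, IsGram A (F k) ∧ ∀ a, a ∉ P → A a a = 0)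
    (hF1 : ∀ k w, (F k).coeff w ≤ 1)
    (hlim : ∀ w, Tendsto (fun k => (F k).coeff w) atTop (𝓝 (f.coeff w))) :
    ∃ A, IsGram A f ∧ ∀ a, a ∉ P → A a a = 0 := by
  choose A hA hAP using hF
  obtain ⟨C, hC⟩ := IsGram.exists_bound P
  have hC' : ∀ k a, A k a a ≤ C := fun k => hC _ _ (hA k) (hAP k) (hF1 k)
  have hmem : ∀ k, A k ∈ Set.pi Set.univ
      fun _ : Fin n →₀ ℕ => Set.pi Set.univ fun _ : Fin n →₀ ℕ => Set.Icc (-C) C := by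
    intro k a _ b _
    have hC0 : 0 ≤ C := ((hA k).nonneg a).trans (hC' k a)
    refine abs_le.1 (abs_le_of_sq_le_sq ?_ hC0)
    calc A k a b ^ 2 ≤ A k a a * A k b b := (hA k).sq_le a b
      _ ≤ C * C := mul_le_mul (hC' k a) (hC' k b) ((hA k).nonneg b) hC0
      _ = C ^ 2 := (sq C).symm
  have hcomp : IsCompact (Set.pi Set.univ
      fun _ : Fin n →₀ ℕ => Set.pi Set.univ fun _ : Fin n →₀ ℕ => Set.Icc (-C) C) :=
    isCompact_univ_pi fun _ => isCompact_univ_pi fun _ => isCompact_Icc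
  -- All conditions on a Gram array involve finitely many entries and are closed, so they survive a
  -- pointwise limit along an ultrafilter.
  obtain ⟨B, -, hB⟩ := hcomp.ultrafilter_le_nhds ((hyperfilter ℕ).map A)
    (by
      rw [le_principal_iff]
      exact Filter.mem_map.2 (Filter.univ_mem' hmem))
  have hB' : ∀ a b, Tendsto (fun k => A k a b) (hyperfilter ℕ) (𝓝 (B a b)) := fun a b =>
    (tendsto_pi_nhds.1 ((tendsto_pi_nhds.1 (show Tendsto A (hyperfilter ℕ) (𝓝 B) from hB)) a)) b
  refine ⟨B, ⟨fun a => ?_, fun a b => ?_, fun w => ?_⟩, fun a ha => ?_⟩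
  · exact ge_of_tendsto' (hB' a a) fun k => (hA k).nonneg a
  · exact le_of_tendsto_of_tendsto' ((hB' a b).pow 2) ((hB' a a).mul (hB' b b))
      fun k => (hA k).sq_le a b
  · refine tendsto_nhds_unique ((hlim w).mono_left Nat.hyperfilter_le_atTop) ?_
    simp only [(hA _).coeff_eq]
    exact tendsto_finsetSum _ fun p _ => hB' p.1 p.2
  · refine tendsto_nhds_unique (hB' a a) ?_
    simp only [hAP _ a ha]
    exact tendsto_const_nhds

end Gram

/-! ### From agiforms to mediated sets -/

section Necessity

variable {n : ℕ} {V : Finset (Fin n →₀ ℕ)} {y : Fin n →₀ ℕ}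

theorem le_one_of_mem_convexCombs {l : V → ℝ} (hl : l ∈ convexCombs V y) (v : V) : l v ≤ 1 :=
  hl.2.1 ▸ Finset.single_le_sum (fun v _ => hl.1 v) (Finset.mem_univ v)

theorem coeff_poly_le_one {l : V → ℝ} (hl : l ∈ convexCombs V y) (w : Fin n →₀ ℕ) :
    (poly V l y).coeff w ≤ 1 := by
  rw [coeff_poly]
  split_ifs with h1 h2 <;> first | linarith [le_one_of_mem_convexCombs hl ⟨w, h1⟩] | norm_num

/-- Coefficients outside `V` are nonpositive, so doubled support points outside `V` are midpoints of
others and the extremal principle applies. -/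
theorem IsGram.pt_add_self_mem_convexHull {A : (Fin n →₀ ℕ) → (Fin n →₀ ℕ) → ℝ} {l : V → ℝ}
    (hA : IsGram A (poly V l y)) (hfin : {a | A a a ≠ 0}.Finite) {a : Fin n →₀ ℕ}
    (ha : A a a ≠ 0) : pt (a + a) ∈ convexHull ℝ (pt '' (V : Set (Fin n →₀ ℕ))) := by
  refine subset_convexHull_of_midpoints (L := (fun a => pt (a + a)) '' {a | A a a ≠ 0})
    (hfin.image _) ?_ ⟨a, ha, rfl⟩
  rintro _ ⟨a, ha, rfl⟩ haV
  have haV' : a + a ∉ V := fun h => haV ⟨a + a, h, rfl⟩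
  obtain ⟨b, c, hbc, hsum, hb, hc⟩ := hA.exists_midpoint ha (by
    rw [coeff_poly, dif_neg haV']; split_ifs <;> norm_num)
  refine ⟨_, ⟨b, hb, rfl⟩, _, ⟨c, hc, rfl⟩, fun h => hbc (add_self_injective (pt_injective h)), ?_⟩
  have : pt b + pt c = pt a + pt a := by rw [← pt_add, hsum, pt_add]
  simp only [pt_add]
  rw [show pt b + pt b + (pt c + pt c) = (2 : ℝ) • (pt b + pt c) by module, this]
  module

theorem exists_isGram_poly {l : V → ℝ} (h : IsSumSq (poly V l y)) :
    ∃ A, IsGram A (poly V l y) ∧ ∀ a, a ∉ Finset.Iic (V.sup id) → A a a = 0 := by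
  obtain ⟨A, hA, hfin⟩ := exists_isGram h
  refine ⟨A, hA, fun a ha => by_contra fun h0 => ha ?_⟩
  rw [Finset.mem_Iic]
  exact le_self_add.trans (le_sup_of_pt_mem_convexHull (hA.pt_add_self_mem_convexHull hfin h0))

theorem convex_convexCombs : Convex ℝ (convexCombs V y) := by
  rintro l ⟨h1, h2, h3⟩ m ⟨k1, k2, k3⟩ a b ha hb hab
  refine ⟨fun v => ?_, ?_, ?_⟩
  · have := h1 v
    have := k1 v
    simp only [Pi.add_apply, Pi.smul_apply, smul_eq_mul]
    positivity
  · simp only [Pi.add_apply, Pi.smul_apply, smul_eq_mul, Finset.sum_add_distrib, ← Finset.mul_sum,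
      h2, k2, mul_one, hab]
  · simp only [Pi.add_apply, Pi.smul_apply, smul_eq_mul, add_smul, mul_smul,
      Finset.sum_add_distrib, ← Finset.smul_sum, h3, k3]
    rw [← add_smul, hab, one_smul]

/-- Points of the hull of `V` are convex combinations indexed by `V`. -/
theorem exists_weights_of_mem_convexHull {x : Fin n → ℝ}
    (hx : x ∈ convexHull ℝ (pt '' (V : Set (Fin n →₀ ℕ)))) :
    ∃ l : V → ℝ, (∀ v, 0 ≤ l v) ∧ ∑ v, l v = 1 ∧ ∑ v, l v • pt (v : Fin n →₀ ℕ) = x := by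
  classical
  rw [← Finset.coe_image] at hx
  obtain ⟨w, h0, h1, h2⟩ := Finset.mem_convexHull'.1 hx
  rw [Finset.sum_image pt_injective.injOn] at h1 h2
  refine ⟨fun v => w (pt v), fun v => h0 _ (Finset.mem_image_of_mem _ v.2), ?_, ?_⟩
  · rw [← h1]; exact Finset.sum_coe_sort V fun v => w (pt v)
  · rw [← h2]; exact Finset.sum_coe_sort V fun v => w (pt v) • pt v

/-- Pushing `y` slightly away from the average `c` of the vertices stays in the hull; averaging back
with `c` makes every weight positive. -/
theorem exists_pos_mem_convexCombs
    (hy : pt y ∈ interior (convexHull ℝ (pt '' (V : Set (Fin n →₀ ℕ))))) :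
    ∃ b ∈ convexCombs V y, ∀ v, 0 < b v := by
  classical
  have hne : Nonempty V := by
    obtain ⟨l, -, h1, -⟩ := exists_weights_of_mem_convexHull (interior_subset hy)
    by_contra h
    rw [not_nonempty_iff] at h
    simp at h1
  set m : ℝ := (Fintype.card V : ℝ) with hm
  have hm0 : 0 < m := by simpa [hm] using Fintype.card_pos (α := V)
  set c : Fin n → ℝ := ∑ v : V, (1 / m) • pt (v : Fin n →₀ ℕ) with hc
  obtain ⟨δ, hδ, hmem⟩ : ∃ δ : ℝ, 0 < δ ∧
      pt y + δ • (pt y - c) ∈ convexHull ℝ (pt '' (V : Set (Fin n →₀ ℕ))) := by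
    have hcont : Filter.Tendsto (fun δ : ℝ => pt y + δ • (pt y - c)) (nhdsWithin 0 (Set.Ioi 0))
        (nhds (pt y)) := by
      have : Continuous fun δ : ℝ => pt y + δ • (pt y - c) := by fun_prop
      simpa using (this.tendsto 0).mono_left nhdsWithin_le_nhds
    have h1 := hcont.eventually (mem_interior_iff_mem_nhds.1 hy)
    obtain ⟨δ, h, hδ⟩ := (h1.and self_mem_nhdsWithin).exists
    exact ⟨δ, hδ, h⟩
  obtain ⟨l, h0, h1, h2⟩ := exists_weights_of_mem_convexHull hmem
  refine ⟨fun v => (1 / (1 + δ)) * (l v + δ / m), ⟨fun v => ?_, ?_, ?_⟩, fun v => ?_⟩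
  · have := h0 v
    positivity
  · rw [← Finset.mul_sum, Finset.sum_add_distrib, h1, Finset.sum_const, Finset.card_univ,
      nsmul_eq_mul, ← hm]
    field_simp
  · simp only [mul_smul, add_smul, ← Finset.smul_sum, Finset.sum_add_distrib, h2]
    have : ∑ v : V, (δ / m) • pt (v : Fin n →₀ ℕ) = δ • c := by
      rw [hc, Finset.smul_sum]
      exact Finset.sum_congr rfl fun v _ => by rw [smul_smul]; ring_nf
    rw [Finset.smul_sum, this]
    match_scalars <;> field_simp
    ring
  · have := h0 v
    positivity

open Filter Topology in
/-- Approximating by agiforms gives Gram arrays for all convex combinations. -/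
theorem exists_isGram_of_agiforms
    (hy : pt y ∈ interior (convexHull ℝ (pt '' (V : Set (Fin n →₀ ℕ)))))
    (h : ∀ f : MvPolynomial (Fin n) ℝ, IsAgiform V y f → IsSumSq f) {l : V → ℝ}
    (hl : l ∈ convexCombs V y) :
    ∃ A, IsGram A (poly V l y) ∧ ∀ a, a ∉ Finset.Iic (V.sup id) → A a a = 0 := by
  obtain ⟨b, hb, hbpos⟩ := exists_pos_mem_convexCombs hy
  set ε : ℕ → ℝ := fun k => 1 / ((k : ℝ) + 1) with hε
  have hε0 : ∀ k, 0 < ε k := fun k => by positivity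
  have hε1 : ∀ k, ε k ≤ 1 := fun k => by
    rw [hε]; exact (div_le_one (by positivity)).2 (by linarith [Nat.cast_nonneg (α := ℝ) k])
  have hεlim : Tendsto ε atTop (𝓝 0) := tendsto_one_div_add_atTop_nhds_zero_nat
  have hmem : ∀ k, (1 - ε k) • l + ε k • b ∈ convexCombs V y := fun k =>
    convex_convexCombs hl hb (by linarith [hε1 k]) (hε0 k).le (by ring)
  refine IsGram.exists_of_tendsto _ (F := fun k => poly V ((1 - ε k) • l + ε k • b) y)
    (fun k => exists_isGram_poly (h _ ⟨_, hmem k, fun v => ?_, rfl⟩))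
    (fun k => coeff_poly_le_one (hmem k)) fun w => ?_
  · have h1 := hl.1 v
    have h2 := hbpos v
    have h3 := hε0 k
    have h4 : 0 ≤ 1 - ε k := by linarith [hε1 k]
    simp only [Pi.add_apply, Pi.smul_apply, smul_eq_mul]
    positivity
  · simp only [coeff_poly]
    refine Tendsto.sub ?_ tendsto_const_nhds
    split_ifs with hw
    · have : Tendsto (fun k => (1 - ε k) * l ⟨w, hw⟩ + ε k * b ⟨w, hw⟩) atTop
          (𝓝 ((1 - 0) * l ⟨w, hw⟩ + 0 * b ⟨w, hw⟩)) :=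
        ((tendsto_const_nhds.sub hεlim).mul_const _).add (hεlim.mul_const _)
      simpa using this
    · exact tendsto_const_nhds

theorem sum_ite_mem_of_subset {M : Type*} [AddCommMonoid M] {s : Finset (Fin n → ℝ)}
    (hs : (s : Set (Fin n → ℝ)) ⊆ pt '' (V : Set (Fin n →₀ ℕ))) (g : (Fin n → ℝ) → M)
    [DecidablePred fun v : Fin n →₀ ℕ => pt v ∈ s] :
    ∑ v : V, (if pt (v : Fin n →₀ ℕ) ∈ s then g (pt v) else 0) = ∑ x ∈ s, g x := by
  classical
  rw [Finset.sum_coe_sort V fun v => if pt v ∈ s then g (pt v) else 0, ← Finset.sum_filter,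
    ← Finset.sum_image (f := g) (s := V.filter fun v => pt v ∈ s) pt_injective.injOn]
  refine Finset.sum_congr ?_ fun _ _ => rfl
  ext x
  simp only [Finset.mem_image, Finset.mem_filter]
  constructor
  · rintro ⟨v, ⟨-, hv⟩, rfl⟩
    exact hv
  · intro hx
    obtain ⟨v, hv, rfl⟩ := hs hx
    exact ⟨v, ⟨hv, hx⟩, rfl⟩

/-- As `l` vanishes off `s`, all coefficients off `s` are nonpositive, and the one at `y` is `-1`
unless `y` is a vertex of `s`. So every point of `L` off `s` is a midpoint, and the extremal
principle places `L` inside the simplex. -/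
theorem mem_maxMediated_of_isGram {A : (Fin n →₀ ℕ) → (Fin n →₀ ℕ) → ℝ} {l : V → ℝ}
    (hA : IsGram A (poly V l y)) (hfin : {a | A a a ≠ 0}.Finite) {s : Finset (Fin n → ℝ)}
    (hs : (s : Set (Fin n → ℝ)) ⊆ pt '' (V : Set (Fin n →₀ ℕ)))
    (hl : ∀ v : V, pt (v : Fin n →₀ ℕ) ∉ s → l v = 0) :
    pt y ∈ maxMediated (s : Set (Fin n → ℝ)) := by
  by_cases hys : pt y ∈ s
  · refine (isGreatest_maxMediated _ fun x hx => ?_).1.vertices_subset hys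
    obtain ⟨v, -, rfl⟩ := hs hx
    exact isLatticePoint_pt v
  have hcoeff : ∀ w, pt w ∉ s → (poly V l y).coeff w = - if w = y then 1 else 0 := by
    intro w hw
    rw [coeff_poly]
    split_ifs with h <;> simp [hl ⟨w, _⟩ hw]
  set L : Set (Fin n → ℝ) := insert (pt y) ((fun a => pt (a + a)) '' {a | A a a ≠ 0} ∪ s) with hL
  have hLfin : L.Finite := ((hfin.image _).union s.finite_toSet).insert _
  have hmed : ∀ x ∈ L, x ∉ (s : Set (Fin n → ℝ)) →
      ∃ u ∈ L, ∃ t ∈ L, u ≠ t ∧ IsEvenPoint u ∧ IsEvenPoint t ∧ x = (1 / 2 : ℝ) • (u + t) := by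
    have hpair : ∀ w b c, b ≠ c → b + c = w → A b b ≠ 0 → A c c ≠ 0 →
        ∃ u ∈ L, ∃ t ∈ L, u ≠ t ∧ IsEvenPoint u ∧ IsEvenPoint t ∧
          pt w = (1 / 2 : ℝ) • (u + t) := by
      intro w b c hbc hsum hb hc
      refine ⟨pt (b + b), Or.inr (Or.inl ⟨b, hb, rfl⟩), pt (c + c), Or.inr (Or.inl ⟨c, hc, rfl⟩),
        fun h => hbc (add_self_injective (pt_injective h)), isEvenPoint_pt_add_self b,
        isEvenPoint_pt_add_self c, ?_⟩
      rw [← hsum]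
      simp only [pt_add]
      module
    rintro x (rfl | ⟨a, ha, rfl⟩ | hx) hxs
    · obtain ⟨b, c, hbc, hsum, hb, hc⟩ := hA.exists_of_coeff_neg (y := y) (by
        rw [hcoeff y hys]; simp)
      exact hpair _ b c hbc hsum hb hc
    · obtain ⟨b, c, hbc, hsum, hb, hc⟩ := hA.exists_midpoint ha (by
        rw [hcoeff _ hxs]; split_ifs <;> norm_num)
      exact hpair _ b c hbc hsum hb hc
    · exact absurd hx hxs
  refine ⟨L, ⟨?_, ?_, fun x hx => Or.inr (Or.inr hx), hmed⟩, Or.inl rfl⟩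
  · refine subset_convexHull_of_midpoints hLfin fun x hx hxs => ?_
    obtain ⟨u, hu, t, ht, hut, -, -, h⟩ := hmed x hx hxs
    exact ⟨u, hu, t, ht, hut, h⟩
  · rintro x (rfl | ⟨a, -, rfl⟩ | hx)
    · exact isLatticePoint_pt y
    · exact isLatticePoint_pt _
    · obtain ⟨v, -, rfl⟩ := hs hx
      exact isLatticePoint_pt v

theorem triangulationCriterion_of_agiforms {Q : Set (Fin n → ℝ)} (hQ : IsLatticePolytope Q V)
    (hy : pt y ∈ interior Q)
    (h : ∀ f : MvPolynomial (Fin n) ℝ, IsAgiform V y f → IsSumSq f) :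
    TriangulationCriterion Q y := by
  classical
  intro K hK s hs hys
  have hsV : (s : Set (Fin n → ℝ)) ⊆ pt '' (V : Set (Fin n →₀ ℕ)) := by
    intro x hx
    rw [← hQ.extremePoints_eq]
    exact hK.vertices_subset (K.down_closed hs.1 (Finset.singleton_subset_iff.2 hx)
      (Finset.singleton_nonempty x))
  obtain ⟨w, hw0, hw1, hwy⟩ := Finset.mem_convexHull'.1 hys
  set l : V → ℝ := fun v => if pt (v : Fin n →₀ ℕ) ∈ s then w (pt v) else 0 with hl
  have hlC : l ∈ convexCombs V y := by
    refine ⟨fun v => ?_, ?_, ?_⟩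
    · rw [hl]; dsimp only
      split_ifs with hv
      · exact hw0 _ hv
      · exact le_rfl
    · rw [← hw1]; exact sum_ite_mem_of_subset hsV w
    · rw [← hwy, ← sum_ite_mem_of_subset hsV fun x => w x • x]
      exact Finset.sum_congr rfl fun v _ => by rw [hl]; dsimp only; split_ifs <;> simp
  obtain ⟨A, hA, hP⟩ := exists_isGram_of_agiforms (hQ.eq_convexHull ▸ hy) h hlC
  refine mem_maxMediated_of_isGram hA ?_ hsV fun v hv => if_neg hv
  refine (Finset.finite_toSet (Finset.Iic (V.sup id))).subset fun a ha => ?_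
  by_contra h'
  exact ha (hP a h')

end Necessity

/-! ### Reduction to affinely independent supports -/

section Reduction

variable {n : ℕ} {V : Finset (Fin n →₀ ℕ)} {y : Fin n →₀ ℕ}

/-- The only affine dependency of the points of `V` that vanishes where `T` fails is trivial. -/
def NoDependency (V : Finset (Fin n →₀ ℕ)) (T : V → Prop) : Prop :=
  ∀ μ : V → ℝ, (∀ v, ¬ T v → μ v = 0) → ∑ v, μ v = 0 →
    ∑ v, μ v • pt (v : Fin n →₀ ℕ) = 0 → ∀ v, μ v = 0

/-- Ratio test: `s` is the least `l v / (-μ v)` over the `v` with `μ v < 0`. -/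
theorem exists_nonneg_add_mul_eq_zero {ι : Type*} [Fintype ι] {l μ : ι → ℝ} (hl : ∀ v, 0 ≤ l v)
    (hμl : ∀ v, l v = 0 → μ v = 0) {v₀ : ι} (hv₀ : μ v₀ < 0) :
    ∃ s : ℝ, 0 < s ∧ (∀ v, 0 ≤ l v + s * μ v) ∧ ∃ v, l v ≠ 0 ∧ l v + s * μ v = 0 := by
  classical
  obtain ⟨v₁, hv₁, hmin⟩ := (Finset.univ.filter fun v => μ v < 0).exists_min_image
    (fun v => l v / (-μ v)) ⟨v₀, by simpa using hv₀⟩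
  have hneg : μ v₁ < 0 := (Finset.mem_filter.1 hv₁).2
  have hl1 : l v₁ ≠ 0 := fun h => hneg.ne (hμl v₁ h)
  have hpos : 0 < l v₁ := (hl v₁).lt_of_ne' hl1
  have hs : 0 < l v₁ / (-μ v₁) := div_pos hpos (by linarith)
  refine ⟨l v₁ / (-μ v₁), hs, fun v => ?_, v₁, hl1, ?_⟩
  · rcases lt_or_ge (μ v) 0 with h | h
    · have := hmin v (by simpa using h)
      rw [le_div_iff₀ (by linarith)] at this
      linarith
    · have := hl v
      positivity
  · have := hneg.ne
    field_simp
    ring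

/-- A dependency `μ` on the support of `l` allows moves along `μ` and `-μ` until a coordinate
vanishes. Thus `l` lies between two points of smaller support, and induction on the support size
applies. -/
theorem convexCombs_subset_of_noDependency {S : Set (V → ℝ)} (hS : Convex ℝ S)
    (h : ∀ l ∈ convexCombs V y, NoDependency V (fun v => l v ≠ 0) → l ∈ S) :
    convexCombs V y ⊆ S := by
  classical
  suffices hk : ∀ k : ℕ, ∀ l ∈ convexCombs V y,
      (Finset.univ.filter fun v => l v ≠ 0).card = k → l ∈ S from
    fun l hl => hk _ l hl rfl
  intro k
  induction k using Nat.strong_induction_on with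
  | _ k ih =>
    intro l hl hk
    by_cases hd : NoDependency V (fun v => l v ≠ 0)
    · exact h l hl hd
    simp only [NoDependency, not_not] at hd
    push Not at hd
    obtain ⟨μ, hμl, hμ0, hμp, v, hv⟩ := hd
    have hstep : ∀ μ : V → ℝ, (∀ v, l v = 0 → μ v = 0) → ∑ v, μ v = 0 →
        ∑ v, μ v • pt (v : Fin n →₀ ℕ) = 0 → (∃ v, μ v ≠ 0) → ∃ s : ℝ, 0 < s ∧ l + s • μ ∈ S := by
      intro μ hμl hμ0 hμp ⟨v, hv⟩
      obtain ⟨v₀, hv₀⟩ : ∃ v₀, μ v₀ < 0 := by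
        by_contra! hnn
        exact hv ((Finset.sum_eq_zero_iff_of_nonneg fun v _ => hnn v).1 hμ0 v (Finset.mem_univ v))
      obtain ⟨s, hs, hnn, v₁, hl1, hz⟩ := exists_nonneg_add_mul_eq_zero hl.1 hμl hv₀
      refine ⟨s, hs, ih _ ?_ _ ⟨hnn, ?_, ?_⟩ rfl⟩
      · rw [← hk]
        refine Finset.card_lt_card (Finset.ssubset_iff_of_subset ?_ |>.2 ⟨v₁, ?_, ?_⟩)
        · intro v hv
          rw [Finset.mem_filter] at hv ⊢
          refine ⟨hv.1, fun h0 => hv.2 ?_⟩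
          simp [h0, hμl v h0]
        · simpa using hl1
        · simpa using hz
      · simp only [Pi.add_apply, Pi.smul_apply, smul_eq_mul, Finset.sum_add_distrib,
          ← Finset.mul_sum, hμ0, hl.2.1, mul_zero, add_zero]
      · simp only [Pi.add_apply, Pi.smul_apply, smul_eq_mul, add_smul, mul_smul,
          Finset.sum_add_distrib, ← Finset.smul_sum, hμp, hl.2.2, smul_zero, add_zero]
    obtain ⟨s, hs, hsS⟩ := hstep μ hμl hμ0 hμp ⟨v, hv⟩
    obtain ⟨s', hs', hsS'⟩ := hstep (-μ) (fun v hv => by simp [hμl v hv])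
      (by simp only [Pi.neg_apply, Finset.sum_neg_distrib, hμ0, neg_zero])
      (by simp only [Pi.neg_apply, neg_smul, Finset.sum_neg_distrib, hμp, neg_zero]) ⟨v, by simpa using hv⟩
    have hss : 0 < s + s' := by positivity
    have := hS hsS hsS' (a := s' / (s + s')) (b := s / (s + s')) (by positivity) (by positivity)
      (by field_simp; ring)
    convert this using 1
    match_scalars <;> field_simp <;> ring

theorem NoDependency.affineIndependent {T : V → Prop} (h : NoDependency V T)
    {t : Finset (Fin n → ℝ)} (ht : (t : Set (Fin n → ℝ)) ⊆ pt '' (V : Set (Fin n →₀ ℕ)))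
    (htT : ∀ v : V, pt (v : Fin n →₀ ℕ) ∈ t → T v) :
    AffineIndependent ℝ ((↑) : t → Fin n → ℝ) := by
  classical
  rw [affineIndependent_iff_of_fintype]
  intro w hw0 hw
  rw [Finset.weightedVSub_eq_linear_combination _ hw0] at hw
  set g : (Fin n → ℝ) → ℝ := fun x => if hx : x ∈ t then w ⟨x, hx⟩ else 0 with hg
  have hgw : ∀ x : t, g x = w x := fun x => by simp [hg]
  have hμ := h (fun v => if pt (v : Fin n →₀ ℕ) ∈ t then g (pt v) else 0)
    (fun v hv => if_neg fun h' => hv (htT v h')) ?_ ?_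
  · rintro ⟨x, hx⟩
    obtain ⟨v, hv, rfl⟩ := ht hx
    have := hμ ⟨v, hv⟩
    rw [if_pos hx] at this
    rw [← hgw ⟨pt v, hx⟩, this]
  · rw [sum_ite_mem_of_subset ht g, ← Finset.sum_coe_sort, ← hw0]
    exact Finset.sum_congr rfl fun x _ => hgw x
  · simp only [ite_smul, zero_smul]
    rw [sum_ite_mem_of_subset ht fun x => g x • x, ← Finset.sum_coe_sort, ← hw]
    exact Finset.sum_congr rfl fun x _ => by rw [hgw x]

theorem noDependency_of_affineIndependent {s : Finset (Fin n → ℝ)}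
    (hs : (s : Set (Fin n → ℝ)) ⊆ pt '' (V : Set (Fin n →₀ ℕ)))
    (hind : AffineIndependent ℝ ((↑) : s → Fin n → ℝ)) :
    NoDependency V fun v => pt (v : Fin n →₀ ℕ) ∈ s := by
  classical
  intro μ hμs hμ0 hμp v
  have hinj : Function.Injective fun v : V => pt (v : Fin n →₀ ℕ) :=
    pt_injective.comp Subtype.val_injective
  set g : (Fin n → ℝ) → ℝ := Function.extend (fun v : V => pt (v : Fin n →₀ ℕ)) μ 0 with hg
  have hgμ : ∀ v : V, g (pt v) = μ v := fun v => hinj.extend_apply μ 0 v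
  by_cases hv : pt (v : Fin n →₀ ℕ) ∈ s
  · rw [← hgμ v]
    refine hind.eq_zero_of_sum_eq_zero_subtype ?_ ?_ _ hv
    · rw [← sum_ite_mem_of_subset hs g]
      refine Eq.trans ?_ hμ0
      refine Finset.sum_congr rfl fun v _ => ?_
      split_ifs with h
      · exact hgμ v
      · exact (hμs v h).symm
    · rw [← sum_ite_mem_of_subset hs fun x => g x • x]
      refine Eq.trans ?_ hμp
      refine Finset.sum_congr rfl fun v _ => ?_
      split_ifs with h
      · rw [hgμ v]
      · rw [hμs v h, zero_smul]
  · exact hμs v hv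

end Reduction

/-! ### From mediated sets to sums of squares -/

section SumSq

variable {n : ℕ} {V : Finset (Fin n →₀ ℕ)} {y : Fin n →₀ ℕ}

theorem isSumSq_smul {f : MvPolynomial (Fin n) ℝ} (hf : IsSumSq f) {c : ℝ} (hc : 0 ≤ c) :
    IsSumSq (c • f) := by
  rw [MvPolynomial.smul_eq_C_mul]
  refine IsSumSq.mul ?_ hf
  rw [← Real.mul_self_sqrt hc, map_mul]
  exact IsSumSq.mul_self _

theorem poly_combination (l m : V → ℝ) {a b : ℝ} (hab : a + b = 1) :
    poly V (a • l + b • m) y = a • poly V l y + b • poly V m y := by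
  ext w
  simp only [MvPolynomial.coeff_add, MvPolynomial.coeff_smul, coeff_poly, smul_eq_mul]
  split_ifs <;> simp <;> linear_combination hab

theorem convex_setOf_isSumSq_poly : Convex ℝ {l : V → ℝ | IsSumSq (poly V l y)} := by
  intro l hl m hm a b ha hb hab
  rw [Set.mem_ofPred_eq, poly_combination l m hab]
  exact (isSumSq_smul hl ha).add (isSumSq_smul hm hb)

/-- A matrix satisfying a minimum principle has a nonnegative inverse. -/
theorem isSumSq_of_minimum_principle {ι : Type*} [Fintype ι] (P : Matrix ι ι ℝ)
    (hP : ∀ g : ι → ℝ, (∀ i, 0 ≤ P.mulVec g i) → ∀ i, 0 ≤ g i)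
    (F : ι → MvPolynomial (Fin n) ℝ) (hF : ∀ i, IsSumSq (∑ j, P i j • F j)) (i : ι) :
    IsSumSq (F i) := by
  classical
  have hinj : Function.Injective P.mulVec := by
    intro g h hgh
    have hle : ∀ g h : ι → ℝ, P.mulVec g = P.mulVec h → ∀ i, h i ≤ g i := fun g h hgh i => by
      have := hP (g - h) (fun i => by rw [Matrix.mulVec_sub, hgh, sub_self]; rfl) i
      simpa using this
    exact funext fun i => le_antisymm (hle h g hgh.symm i) (hle g h hgh i)
  have hu : IsUnit P := Matrix.mulVec_injective_iff_isUnit.1 hinj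
  have hdet : IsUnit P.det := (Matrix.isUnit_iff_isUnit_det P).1 hu
  -- `P` sends each column of its inverse to a unit vector, which is nonnegative.
  have hnn : ∀ i j, 0 ≤ P⁻¹ i j := fun i j => by
    have := hP (fun i => P⁻¹ i j) (fun k => ?_) i
    · exact this
    · have e : P.mulVec (fun i => P⁻¹ i j) k = (P * P⁻¹) k j := rfl
      rw [e, Matrix.mul_nonsing_inv P hdet, Matrix.one_apply]
      split_ifs <;> norm_num
  have hFi : F i = ∑ j, P⁻¹ i j • ∑ k, P j k • F k := by
    simp only [Finset.smul_sum, smul_smul]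
    rw [Finset.sum_comm]
    simp only [← Finset.sum_smul, ← Matrix.mul_apply, Matrix.nonsing_inv_mul P hdet,
      Matrix.one_apply, ite_smul, one_smul, zero_smul]
    simp
  rw [hFi]
  exact IsSumSq.sum fun j _ => isSumSq_smul (hF j) (hnn i j)

theorem exists_eq_pt_of_isLatticePoint {x : Fin n → ℝ} (hx : IsLatticePoint x)
    (h : x ∈ convexHull ℝ (pt '' (V : Set (Fin n →₀ ℕ)))) : ∃ a, x = pt a := by
  have hnn : ∀ i, 0 ≤ x i := by
    intro i
    have hc : Convex ℝ {x : Fin n → ℝ | 0 ≤ x i} :=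
      convex_halfSpace_ge (f := fun x : Fin n → ℝ => x i) ⟨fun _ _ => rfl, fun _ _ => rfl⟩ _
    refine convexHull_min ?_ hc h
    rintro _ ⟨v, -, rfl⟩
    simp [pt]
  choose k hk using hx
  refine ⟨Finsupp.equivFunOnFinite.symm fun i => (k i).toNat, funext fun i => ?_⟩
  have hki : 0 ≤ k i := by exact_mod_cast hk i ▸ hnn i
  rw [hk i]
  simp only [pt, Finsupp.equivFunOnFinite_symm_apply_apply]
  exact_mod_cast (Int.toNat_of_nonneg hki).symm

theorem exists_add_self_of_isEvenPoint {a : Fin n →₀ ℕ} (h : IsEvenPoint (pt a)) :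
    ∃ b, a = b + b := by
  refine ⟨Finsupp.equivFunOnFinite.symm fun i => a i / 2, Finsupp.ext fun i => ?_⟩
  obtain ⟨k, hk⟩ := h i
  have : (a i : ℤ) = 2 * k := by
    have hk' : ((a i : ℕ) : ℝ) = 2 * k := hk
    exact_mod_cast hk'
  simp only [Finsupp.add_apply, Finsupp.equivFunOnFinite_symm_apply_apply]
  lia

/-- The vertex terms cancel, leaving the AM-GM identity `x^(2b)/2 + x^(2c)/2 - x^(b+c) = (x^b -
x^c)²/2`. -/
theorem poly_sub_midpoint (p q : V → ℝ) (b c : Fin n →₀ ℕ) :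
    poly V ((1 / 2 : ℝ) • p + (1 / 2 : ℝ) • q) (b + c) - (1 / 2 : ℝ) • poly V p (b + b) -
        (1 / 2 : ℝ) • poly V q (c + c) =
      (1 / 2 : ℝ) • ((MvPolynomial.monomial b 1 - MvPolynomial.monomial c 1) *
        (MvPolynomial.monomial b 1 - MvPolynomial.monomial c 1)) := by
  rw [poly_combination p q (by norm_num)]
  have e : ∀ (l : V → ℝ) (w : Fin n →₀ ℕ), poly V l w =
      ∑ v : V, MvPolynomial.monomial (v : Fin n →₀ ℕ) (l v) - MvPolynomial.monomial w 1 :=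
    fun _ _ => rfl
  have h2 : ∀ u w : Fin n →₀ ℕ, (MvPolynomial.monomial u (1 : ℝ)) * MvPolynomial.monomial w 1 =
      MvPolynomial.monomial (u + w) 1 := fun u w => by
    rw [MvPolynomial.monomial_mul, one_mul]
  simp only [e, sub_mul, mul_sub, h2, add_comm c b]
  module

theorem poly_single {a : Fin n →₀ ℕ} (ha : a ∈ V) [DecidableEq V] :
    poly V (Pi.single ⟨a, ha⟩ 1) a = 0 := by
  ext w
  rw [coeff_poly]
  by_cases hw : w = a
  · subst hw; simp [ha]
  · have : ∀ h : w ∈ V, (⟨w, h⟩ : V) ≠ ⟨a, ha⟩ := fun h h' => hw (congrArg Subtype.val h')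
    split_ifs with h
    · simp [hw]
    · simp

/-- A simplicial agiform whose inner exponent is mediated is a sum of squares. -/
theorem isSumSq_poly_of_mem_maxMediated {s : Finset (Fin n → ℝ)}
    (hs : (s : Set (Fin n → ℝ)) ⊆ pt '' (V : Set (Fin n →₀ ℕ)))
    (hind : AffineIndependent ℝ ((↑) : s → Fin n → ℝ))
    (hy : pt y ∈ maxMediated (s : Set (Fin n → ℝ))) {l : V → ℝ} (hl : l ∈ convexCombs V y)
    (hls : ∀ v : V, pt (v : Fin n →₀ ℕ) ∉ s → l v = 0) : IsSumSq (poly V l y) := by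
  classical
  obtain ⟨L, hL, hyL⟩ := hy
  have hno := noDependency_of_affineIndependent hs hind
  have huniq : ∀ p q : V → ℝ, (∀ v : V, pt (v : Fin n →₀ ℕ) ∉ s → p v = 0) →
      (∀ v : V, pt (v : Fin n →₀ ℕ) ∉ s → q v = 0) → ∑ v, p v = 1 → ∑ v, q v = 1 →
      ∑ v, p v • pt (v : Fin n →₀ ℕ) = ∑ v, q v • pt (v : Fin n →₀ ℕ) → p = q := by
    intro p q hp hq hp1 hq1 hpq
    refine funext fun v => sub_eq_zero.1 (hno (p - q) (fun v hv => ?_) ?_ ?_ v)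
    · simp [hp v hv, hq v hv]
    · simp only [Pi.sub_apply, Finset.sum_sub_distrib, hp1, hq1, sub_self]
    · simp only [Pi.sub_apply, sub_smul, Finset.sum_sub_distrib, hpq, sub_self]
  have hLV : L ⊆ convexHull ℝ (pt '' (V : Set (Fin n →₀ ℕ))) :=
    hL.subset_convexHull.trans (convexHull_mono hs)
  set I : Finset (Fin n →₀ ℕ) := (Finset.Iic (V.sup id)).filter fun a => pt a ∈ L with hI
  have hmemI : ∀ {a : Fin n →₀ ℕ}, pt a ∈ L → a ∈ I := fun ha =>
    Finset.mem_filter.2 ⟨Finset.mem_Iic.2 (le_sup_of_pt_mem_convexHull (hLV ha)), ha⟩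
  have hIL : ∀ a : I, pt (a : Fin n →₀ ℕ) ∈ L := fun a => (Finset.mem_filter.1 a.2).2
  have hweights : ∀ a : I, ∃ p : V → ℝ, (∀ v : V, pt (v : Fin n →₀ ℕ) ∉ s → p v = 0) ∧
      ∑ v, p v = 1 ∧ ∑ v, p v • pt (v : Fin n →₀ ℕ) = pt (a : Fin n →₀ ℕ) := by
    intro a
    obtain ⟨w, -, hw1, hwa⟩ := Finset.mem_convexHull'.1 (hL.subset_convexHull (hIL a))
    refine ⟨fun v => if pt (v : Fin n →₀ ℕ) ∈ s then w (pt v) else 0, fun v hv => if_neg hv,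
      ?_, ?_⟩
    · rw [← hw1]; exact sum_ite_mem_of_subset hs w
    · rw [← hwa, ← sum_ite_mem_of_subset hs fun x => w x • x]
      exact Finset.sum_congr rfl fun v _ => by dsimp only; split_ifs <;> simp
  choose β hβs hβ1 hβa using hweights
  -- At vertices of `s` the two points are dummies.
  have hmid : ∀ a : I, ∃ u w : I, pt (a : Fin n →₀ ℕ) ∉ s → ∃ b c, b ≠ c ∧
      (u : Fin n →₀ ℕ) = b + b ∧ (w : Fin n →₀ ℕ) = c + c ∧ (a : Fin n →₀ ℕ) = b + c := by
    intro a
    by_cases has : pt (a : Fin n →₀ ℕ) ∈ s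
    · exact ⟨a, a, fun h => absurd has h⟩
    obtain ⟨x, hx, z, hz, hxz, hxe, hze, hxza⟩ := hL.mediated _ (hIL a) (by exact_mod_cast has)
    obtain ⟨u, rfl⟩ := exists_eq_pt_of_isLatticePoint (hL.isLatticePoint x hx) (hLV hx)
    obtain ⟨w, rfl⟩ := exists_eq_pt_of_isLatticePoint (hL.isLatticePoint z hz) (hLV hz)
    obtain ⟨b, rfl⟩ := exists_add_self_of_isEvenPoint hxe
    obtain ⟨c, rfl⟩ := exists_add_self_of_isEvenPoint hze
    refine ⟨⟨b + b, hmemI hx⟩, ⟨c + c, hmemI hz⟩, fun _ => ⟨b, c, ?_, rfl, rfl, ?_⟩⟩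
    · rintro rfl; exact hxz rfl
    · apply pt_injective
      rw [hxza]
      simp only [pt_add]
      module
  choose m₁ m₂ hm using hmid
  -- Rows at vertices are unit vectors; any other row subtracts from the value at `a` the mean of
  -- the values at its two mediating points.
  set P : Matrix I I ℝ := Matrix.of fun a j => (if j = a then 1 else 0) -
    if pt (a : Fin n →₀ ℕ) ∈ s then 0
      else ((if j = m₁ a then 1 / 2 else 0) + if j = m₂ a then 1 / 2 else 0) with hP
  have hPsum : ∀ {M : Type} [AddCommGroup M] [Module ℝ M] (G : I → M) (a : I),
      ∑ j, P a j • G j = G a - if pt (a : Fin n →₀ ℕ) ∈ s then 0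
        else ((1 / 2 : ℝ) • G (m₁ a) + (1 / 2 : ℝ) • G (m₂ a)) := by
    intro M _ _ G a
    simp only [hP, Matrix.of_apply, sub_smul, Finset.sum_sub_distrib, ite_smul, one_smul, zero_smul]
    congr 1
    · simp
    · split_ifs
      · simp
      · simp only [add_smul, ite_smul, zero_smul, Finset.sum_add_distrib]
        simp
  -- The set where `g` attains a negative minimum contains no vertex of `s` and, with each point,
  -- both its mediating points. The extremal principle with `D = ∅` shows that it is empty.
  have hmin : ∀ g : I → ℝ, (∀ i, 0 ≤ P.mulVec g i) → ∀ i, 0 ≤ g i := by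
    intro g hg
    by_contra! hneg
    obtain ⟨i, hi⟩ := hneg
    obtain ⟨a₀, -, hmin⟩ := Finset.univ.exists_min_image g ⟨i, Finset.mem_univ i⟩
    have hneg0 : g a₀ < 0 := (hmin i (Finset.mem_univ i)).trans_lt hi
    have hsub := subset_convexHull_of_midpoints (D := ∅)
      (L := (fun a : I => pt (a : Fin n →₀ ℕ)) '' {a | g a = g a₀}) (Set.toFinite _) ?_
    · simpa using hsub ⟨a₀, rfl, rfl⟩
    · rintro _ ⟨a, ha, rfl⟩ -
      have hga : 0 ≤ ∑ j, P a j • g j := hg a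
      rw [hPsum] at hga
      have ha' : g a = g a₀ := ha
      by_cases has : pt (a : Fin n →₀ ℕ) ∈ s
      · rw [if_pos has] at hga; linarith
      · rw [if_neg has, smul_eq_mul, smul_eq_mul] at hga
        have h1 := hmin (m₁ a) (Finset.mem_univ _)
        have h2 := hmin (m₂ a) (Finset.mem_univ _)
        obtain ⟨b, c, hbc, hb, hc, habc⟩ := hm a has
        refine ⟨_, ⟨m₁ a, show g (m₁ a) = g a₀ by linarith, rfl⟩, _,
          ⟨m₂ a, show g (m₂ a) = g a₀ by linarith, rfl⟩, ?_, ?_⟩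
        · simp only [hb, hc]
          exact fun h => hbc (add_self_injective (pt_injective h))
        · simp only [hb, hc, habc, pt_add]
          module
  have hmain := isSumSq_of_minimum_principle P hmin (fun a => poly V (β a) a) (fun a => ?_)
    ⟨y, hmemI hyL⟩
  · have : β ⟨y, hmemI hyL⟩ = l :=
      huniq _ _ (hβs _) hls (hβ1 _) hl.2.1 ((hβa _).trans hl.2.2.symm)
    rwa [this] at hmain
  · rw [hPsum]
    split_ifs with has
    · obtain ⟨v, hv, hva⟩ := hs has
      obtain rfl := pt_injective hva
      have : β a = Pi.single ⟨a, hv⟩ 1 := by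
        refine huniq _ _ (hβs a) (fun v hv' => ?_) (hβ1 a) (by simp) ?_
        · refine Pi.single_eq_of_ne ?_ _
          rintro rfl
          exact hv' has
        · rw [hβa, Finset.sum_eq_single ⟨(a : Fin n →₀ ℕ), hv⟩]
          · simp
          · intro v _ hv'
            rw [Pi.single_eq_of_ne hv', zero_smul]
          · simp
      rw [this, poly_single hv, sub_zero]
      exact IsSumSq.zero
    · obtain ⟨b, c, -, hb, hc, habc⟩ := hm a has
      have : β a = (1 / 2 : ℝ) • β (m₁ a) + (1 / 2 : ℝ) • β (m₂ a) := by
        refine huniq _ _ (hβs a) (fun v hv => ?_) (hβ1 a) ?_ ?_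
        · simp [hβs _ v hv]
        · simp only [Pi.add_apply, Pi.smul_apply, smul_eq_mul, Finset.sum_add_distrib,
            ← Finset.mul_sum, hβ1]
          norm_num
        · simp only [Pi.add_apply, Pi.smul_apply, smul_eq_mul, add_smul, mul_smul,
            Finset.sum_add_distrib, ← Finset.smul_sum, hβa, hb, hc, habc, pt_add]
          module
      rw [this, habc, hb, hc, ← sub_sub, poly_sub_midpoint]
      exact isSumSq_smul (IsSumSq.mul_self _) (by norm_num)

theorem sosSet_eq_of_triangulationCriterion {Q : Set (Fin n → ℝ)} (hQ : IsLatticePolytope Q V)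
    (h : TriangulationCriterion Q y) : sosSet V y = convexCombs V y := by
  classical
  refine Set.Subset.antisymm (fun l hl => hl.1) fun l hl => ⟨hl, ?_⟩
  refine convexCombs_subset_of_noDependency (S := {l : V → ℝ | IsSumSq (poly V l y)})
    convex_setOf_isSumSq_poly (fun l hl hno => ?_) hl
  set A : Finset (Fin n → ℝ) := V.image pt with hA
  have hAV : (A : Set (Fin n → ℝ)) = pt '' (V : Set (Fin n →₀ ℕ)) := Finset.coe_image
  set t : Finset (Fin n → ℝ) := (Finset.univ.filter fun v : V => l v ≠ 0).image
    fun v : V => pt (v : Fin n →₀ ℕ) with ht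
  have hmem : ∀ v : V, pt (v : Fin n →₀ ℕ) ∈ t ↔ l v ≠ 0 := by
    intro v
    rw [ht, Finset.mem_image]
    constructor
    · rintro ⟨u, hu, huv⟩
      obtain rfl : u = v := Subtype.ext (pt_injective huv)
      exact (Finset.mem_filter.1 hu).2
    · exact fun hv => ⟨v, Finset.mem_filter.2 ⟨Finset.mem_univ v, hv⟩, rfl⟩
  have htA : t ⊆ A := by
    intro x hx
    obtain ⟨v, -, rfl⟩ := Finset.mem_image.1 hx
    exact Finset.mem_image_of_mem _ v.2
  have hne : t.Nonempty := by
    obtain ⟨v, -, hv⟩ := Finset.exists_ne_zero_of_sum_ne_zero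
      (hl.2.1.trans_ne one_ne_zero)
    exact ⟨_, (hmem v).2 hv⟩
  -- A vertex of `Q` lying in a smaller hull is extreme there, hence one of its generators.
  have hpos : ∀ p ∈ A, ∀ B ⊆ A, p ∈ convexHull ℝ (B : Set (Fin n → ℝ)) → p ∈ B := by
    intro p hp B hBA hpB
    have hpQ : p ∈ Q.extremePoints ℝ := by
      rw [hQ.extremePoints_eq, ← hAV]; exact hp
    have hBQ : convexHull ℝ (B : Set (Fin n → ℝ)) ⊆ Q := by
      rw [hQ.eq_convexHull, ← hAV]; exact convexHull_mono (by exact_mod_cast hBA)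
    exact_mod_cast extremePoints_convexHull_subset
      (inter_extremePoints_subset_extremePoints_of_subset hBQ ⟨hpB, hpQ⟩)
  obtain ⟨K, hsp, hv, htK⟩ := exists_triangulation_extending A t htA hne
    (hno.affineIndependent (hAV ▸ (by exact_mod_cast htA)) fun v => (hmem v).1) hpos
  obtain ⟨s, hsK, hts⟩ := exists_facet_superset hv htK
  have hsV : (s : Set (Fin n → ℝ)) ⊆ pt '' (V : Set (Fin n →₀ ℕ)) := by
    intro x hx
    rw [← hAV]
    exact hv (K.down_closed hsK.1 (Finset.singleton_subset_iff.2 hx)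
      (Finset.singleton_nonempty x))
  have hls : ∀ v : V, pt (v : Fin n →₀ ℕ) ∉ s → l v = 0 := fun v hv => by
    by_contra h0
    exact hv (hts ((hmem v).2 h0))
  have hys : pt y ∈ convexHull ℝ (s : Set (Fin n → ℝ)) := by
    rw [← hl.2.2, ← Finset.sum_subset (Finset.subset_univ (Finset.univ.filter fun v : V => l v ≠ 0))
      fun v _ hv => by rw [show l v = 0 by simpa using hv, zero_smul]]
    refine (convex_convexHull ℝ _).sum_mem (fun v _ => hl.1 v) ?_ fun v hv =>
      subset_convexHull ℝ _ (hts ((hmem v).2 (Finset.mem_filter.1 hv).2))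
    rw [Finset.sum_filter_ne_zero, hl.2.1]
  refine isSumSq_poly_of_mem_maxMediated hsV (K.indep hsK.1) (h K ⟨?_, ?_⟩ s hsK hys) hl hls
  · rw [hsp, hAV, hQ.eq_convexHull]
  · rw [hQ.extremePoints_eq, ← hAV]; exact hv

end SumSq

end Agiform

/-! ### The equivalences -/

theorem mainTheorem6 {n : ℕ} (Q : Set (Fin n → ℝ)) (V : Finset (Fin n →₀ ℕ))
    (hQ : Agiform.IsLatticePolytope Q V)
    (heven : ∀ v ∈ V, ∀ i, Even (v i))
    (y : Fin n →₀ ℕ) (hy : Agiform.pt y ∈ interior Q) :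
    (Agiform.sosSet V y = Agiform.convexCombs V y ↔ Agiform.TriangulationCriterion Q y) ∧
    ((∀ f : MvPolynomial (Fin n) ℝ, Agiform.IsAgiform V y f → IsSumSq f) ↔
      Agiform.TriangulationCriterion Q y) := by
  have h23 := Agiform.triangulationCriterion_of_agiforms hQ hy
  have h31 := Agiform.sosSet_eq_of_triangulationCriterion (y := y) hQ
  have h12 : Agiform.sosSet V y = Agiform.convexCombs V y →
      ∀ f : MvPolynomial (Fin n) ℝ, Agiform.IsAgiform V y f → IsSumSq f := by
    rintro h _ ⟨b, hb, -, rfl⟩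
    rw [← h] at hb
    exact hb.2
  exact ⟨⟨fun h => h23 (h12 h), h31⟩, ⟨h23, fun h => h12 (h31 h)⟩⟩
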